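/- Let $M$ be a complex manifold of complex dimension $n$ with complex structure $J$. An $SU(n)$-structure on $M$ is a pair $(g,\Omega)$ of a Riemannian metric and a smooth complex $n$-form such that every tangent space has a complex-linear isomorphism with $\mathbb{C}^n$ taking $g$ to the Euclidean inner product and $\Omega$ to $dz_1\wedge\dots\wedge dz_n$; put $\omega(v,w)=g(Jv,w)$. The triple $(M,g,\Omega)$ is a locally conformal Calabi-Yau manifold if every point has an open neighbourhood $U$ with a smooth function $\Delta_U\colon U\to(0,\infty)$ such that $\Delta_U\,g$ is a Ricci-flat Kähler metric on $U$ for whose Levi-Civita connection the form $\Delta_U^{n/2}\,\Omega$ is parallel. A Lee form of $(M,g,\Omega)$ is a smooth closed real $1$-form $\varphi$ on $M$ with $d\omega=\varphi\wedge\omega$ that is, near every point, of the form $-d\log\Delta_U$ for such a $\Delta_U$. **Corollary.** Let $(M,g,\Omega)$ be a simply connected locally conformal Calabi-Yau manifold of complex dimension $n$. Then it has exactly one Lee form $\varphi$, and $\varphi$ is exact. More precisely, there is a smooth function $f\colon M\to\mathbb{R}$ with $\varphi=df$ such that, with $g'=e^{-f}g$ and $\Omega'=e^{-nf/2}\,\Omega$,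 the pair $(g',\Omega')$ is an $SU(n)$-structure, $g'$ is a Kähler and Ricci-flat metric on all of $M$, and $\Omega'$ is a holomorphic $(n,0)$-form which is parallel for the Levi-Civita connection of $g'$. In particular $(M,g')$ is a Calabi-Yau manifold: it is Kähler, its canonical bundle is holomorphically trivial, and the holonomy of $g'$ is contained in $SU(n)$. -/

import Mathlib

set_option maxSynthPendingDepth 3

open scoped Manifold ContDiff Topology

noncomputable section

namespace LCCY

/-! ### Local tensor calculus on a real vector space `E` -/

section Local

variable {E : Type*} [NormedAddCommGroup E] [NormedSpace ℝ E]

/-- Christoffel symbols `Γ(u, v)` of a metric `G` on (an open subset of) `E`, given by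
`G(Γ(u, v), w) = ½ (D_u G(v, w) + D_v G(u, w) - D_w G(u, v))`. -/
def christoffel (G : E → E →L[ℝ] E →L[ℝ] ℝ) (p : E) : E →L[ℝ] E →L[ℝ] E :=
  let D : E →L[ℝ] E →L[ℝ] E →L[ℝ] ℝ := fderiv ℝ G p
  let T : E →L[ℝ] E →L[ℝ] E →L[ℝ] ℝ :=
    ((ContinuousLinearMap.flipₗᵢ ℝ E E ℝ).toContinuousLinearEquiv :
      (E →L[ℝ] E →L[ℝ] ℝ) →L[ℝ] (E →L[ℝ] E →L[ℝ] ℝ)).comp D.flip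
  let K : E →L[ℝ] E →L[ℝ] E →L[ℝ] ℝ := (1 / 2 : ℝ) • (D + D.flip - T)
  (ContinuousLinearMap.compL ℝ E (E →L[ℝ] ℝ) E (ContinuousLinearMap.inverse (G p))).comp K

/-- The endomorphism `u ↦ R(u, v) w`, where `R` is the curvature tensor of the Levi-Civita
connection of `G`:
`R(u, v) w = (D_u Γ)(v, w) - (D_v Γ)(u, w) + Γ(u, Γ(v, w)) - Γ(v, Γ(u, w))`. -/
def curvature (G : E → E →L[ℝ] E →L[ℝ] ℝ) (p v w : E) : E →L[ℝ] E :=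
  let Γ : E →L[ℝ] E →L[ℝ] E := christoffel G p
  let D : E →L[ℝ] E →L[ℝ] E →L[ℝ] E := fderiv ℝ (christoffel G) p
  (D.flip v).flip w - (D v).flip w + Γ.flip (Γ v w) - (Γ v).comp (Γ.flip w)

/-- The Ricci tensor `Ric(v, w) = tr (u ↦ R(u, v) w)` of `G`. -/
def ricci (G : E → E →L[ℝ] E →L[ℝ] ℝ) (p v w : E) : ℝ :=
  LinearMap.trace ℝ E (curvature G p v w : E →ₗ[ℝ] E)

/-- The exterior derivative of a `1`-form on `E`. -/
def extDerivOne (a : E → E →L[ℝ] ℝ) (p u v : E) : ℝ :=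
  fderiv ℝ a p u v - fderiv ℝ a p v u

/-- The exterior derivative of a `2`-form (a skew-symmetric bilinear form) on `E`. -/
def extDerivTwo (B : E → E →L[ℝ] E →L[ℝ] ℝ) (p u v w : E) : ℝ :=
  fderiv ℝ B p u v w + fderiv ℝ B p v w u + fderiv ℝ B p w u v

/-- The wedge product of a `1`-form and a `2`-form. -/
def wedgeOneTwo (a : E →L[ℝ] ℝ) (B : E →L[ℝ] E →L[ℝ] ℝ) (u v w : E) : ℝ :=
  a u * B v w + a v * B w u + a w * B u v

/-- The covariant derivative `(∇_u W)(v₁, …, vₙ)` of an `n`-form `W` on `E` with respect to the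
Levi-Civita connection of `G`. -/
def covDeriv {n : ℕ} (G : E → E →L[ℝ] E →L[ℝ] ℝ) (W : E → E [⋀^Fin n]→L[ℝ] ℂ)
    (p u : E) (v : Fin n → E) : ℂ :=
  fderiv ℝ W p u v - ∑ i, W p (Function.update v i (christoffel G p u (v i)))

end Local

/-! ### Tensor fields on a complex manifold `M` modelled on `E` -/

section Manifold

/-- Multiplication by `i`, as a real-linear map. -/
def mulI {E : Type*} [NormedAddCommGroup E] [NormedSpace ℂ E] : E →L[ℝ] E :=
  Complex.I • ContinuousLinearMap.id ℝ E

/-- A complex manifold is in particular a smooth real manifold. -/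
instance realManifold {E : Type*} [NormedAddCommGroup E] [NormedSpace ℂ E]
    {M : Type*} [TopologicalSpace M] [ChartedSpace E M] [IsManifold 𝓘(ℂ, E) ω M] :
    IsManifold 𝓘(ℝ, E) ∞ M := by
  apply isManifold_of_contDiffOn
  intro e e' he he'
  have h := (contDiffGroupoid ω 𝓘(ℂ, E)).compatible he he'
  rw [contDiffGroupoid, mem_groupoid_of_pregroupoid] at h
  have h1 := h.1
  simp only [contDiffPregroupoid] at h1
  exact (h1.restrict_scalars ℝ).of_le le_top

variable (E : Type*) [NormedAddCommGroup E] [NormedSpace ℂ E]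
  (M : Type*) [TopologicalSpace M] [ChartedSpace E M]

/-- Fields of real bilinear forms on the tangent spaces of `M`. -/
abbrev BilinField : Type _ :=
  ∀ x : M, TangentSpace 𝓘(ℝ, E) x →L[ℝ] TangentSpace 𝓘(ℝ, E) x →L[ℝ] ℝ

/-- Real `1`-forms on `M`. -/
abbrev OneForm : Type _ := ∀ x : M, TangentSpace 𝓘(ℝ, E) x →L[ℝ] ℝ

/-- Complex-valued `n`-forms on `M`. -/
abbrev CForm (n : ℕ) : Type _ := ∀ x : M, TangentSpace 𝓘(ℝ, E) x [⋀^Fin n]→L[ℝ] ℂ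

/-- Smooth Riemannian metrics on `M`. -/
abbrev Metric [IsManifold 𝓘(ℂ, E) ω M] : Type _ :=
  Bundle.ContMDiffRiemannianMetric 𝓘(ℝ, E) ∞ E (fun x : M => TangentSpace 𝓘(ℝ, E) x)

variable {E M}

/-- The complex structure of `M` on the tangent space at `x`. -/
def J (x : M) : TangentSpace 𝓘(ℝ, E) x →L[ℝ] TangentSpace 𝓘(ℝ, E) x :=
  (mulI : E →L[ℝ] E)

/-- The fundamental form `ω(v, w) = h(J v, w)` of a Hermitian metric `h`. -/
def fundamentalForm (h : BilinField E M) : BilinField E M := fun x => (h x).comp (J x)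

/-- The derivative of the inverse of a chart. -/
def chartFrame (e : OpenPartialHomeomorph M E) (p : E) :
    E →L[ℝ] TangentSpace 𝓘(ℝ, E) (e.symm p) :=
  mfderiv 𝓘(ℝ, E) 𝓘(ℝ, E) e.symm p

/-- A field of bilinear forms, read in a chart. -/
def BilinField.inChart (h : BilinField E M) (e : OpenPartialHomeomorph M E) (p : E) :
    E →L[ℝ] E →L[ℝ] ℝ :=
  let B : E →L[ℝ] E →L[ℝ] ℝ := h (e.symm p)
  let A : E →L[ℝ] E := chartFrame e p
  B.bilinearComp A A

/-- A `1`-form, read in a chart. -/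
def OneForm.inChart (φ : OneForm E M) (e : OpenPartialHomeomorph M E) (p : E) : E →L[ℝ] ℝ :=
  (φ (e.symm p)).comp (chartFrame e p)

/-- An `n`-form, read in a chart. -/
def CForm.inChart {n : ℕ} (Ω : CForm E M n) (e : OpenPartialHomeomorph M E) (p : E) :
    E [⋀^Fin n]→L[ℝ] ℂ :=
  (Ω (e.symm p)).compContinuousLinearMap (chartFrame e p)

/-- `h` is Kähler on `U`: it is `J`-invariant and its fundamental form is closed. -/
structure IsKahlerOn (h : BilinField E M) (U : Set M) : Prop where
  hermitian : ∀ x ∈ U, ∀ v w : TangentSpace 𝓘(ℝ, E) x, h x (J x v) (J x w) = h x v w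
  closed : ∀ e ∈ atlas E M, ∀ x ∈ e.source ∩ U, ∀ u v w : E,
    extDerivTwo ((fundamentalForm h).inChart e) (e x) u v w = 0

/-- The Ricci tensor of `h` vanishes on `U`. -/
def IsRicciFlatOn (h : BilinField E M) (U : Set M) : Prop :=
  ∀ e ∈ atlas E M, ∀ x ∈ e.source ∩ U, ∀ v w : E, ricci (h.inChart e) (e x) v w = 0

/-- `Ω` is parallel on `U` for the Levi-Civita connection of `h`. -/
def IsParallelOn {n : ℕ} (h : BilinField E M) (Ω : CForm E M n) (U : Set M) : Prop :=
  ∀ e ∈ atlas E M, ∀ x ∈ e.source ∩ U, ∀ (u : E) (v : Fin n → E),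
    covDeriv (h.inChart e) (Ω.inChart e) (e x) u v = 0

/-- `Ω` is smooth. -/
def CForm.IsSmooth {n : ℕ} (Ω : CForm E M n) : Prop :=
  ∀ e ∈ atlas E M, ContDiffOn ℝ ∞ (Ω.inChart e) e.target

/-- The `n`-form `Ω` is of type `(n, 0)`, that is, complex-multilinear. -/
def CForm.IsTypeN0 {n : ℕ} (Ω : CForm E M n) : Prop :=
  ∀ (x : M) (v : Fin n → TangentSpace 𝓘(ℝ, E) x) (i : Fin n),
    Ω x (Function.update v i (J x (v i))) = Complex.I * Ω x v

/-- `Ω` is a holomorphic `(n, 0)`-form. -/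
structure CForm.IsHolomorphic {n : ℕ} (Ω : CForm E M n) : Prop where
  typeN0 : Ω.IsTypeN0
  holomorphic : ∀ e ∈ atlas E M, ∀ v : Fin n → E,
    DifferentiableOn ℂ (fun p => Ω.inChart e p v) e.target

/-- `(h, J, Ω)` is an `SU(n)`-structure: `Ω` is smooth, and at every point there is a linear
isomorphism of the tangent space with `ℂⁿ` that carries `J`, `h` and `Ω` to multiplication by `i`,
the Euclidean inner product and `dz₁ ∧ ⋯ ∧ dzₙ`. -/
structure IsSUStructure {n : ℕ} (h : BilinField E M) (Ω : CForm E M n) : Prop where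
  smooth : Ω.IsSmooth
  frame : ∀ x : M, ∃ L : TangentSpace 𝓘(ℝ, E) x ≃L[ℝ] (Fin n → ℂ),
    (∀ v, L (J x v) = Complex.I • L v) ∧
    (∀ v w, h x v w = (star (L v) ⬝ᵥ L w).re) ∧
    (∀ v : Fin n → TangentSpace 𝓘(ℝ, E) x, Ω x v = Matrix.det (Matrix.of fun i j => L (v i) j))

/-- The conformally rescaled metric `Δ h`. -/
def rescaleMetric (Δ : M → ℝ) (h : BilinField E M) : BilinField E M := fun x => Δ x • h x

/-- The correspondingly rescaled `n`-form `Δ^(n/2) Ω`. -/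
def rescaleForm {n : ℕ} (Δ : M → ℝ) (Ω : CForm E M n) : CForm E M n :=
  fun x => (Real.sqrt (Δ x) ^ n) • Ω x

/-- `Δ` is a smooth positive function on the open set `U` such that `Δ h` is a Ricci-flat Kähler
metric on `U` for which `Δ^(n/2) Ω` is parallel. -/
structure IsLocalFactor {n : ℕ} (h : BilinField E M) (Ω : CForm E M n) (U : Set M) (Δ : M → ℝ) :
    Prop where
  isOpen : IsOpen U
  smooth : ContMDiffOn 𝓘(ℝ, E) 𝓘(ℝ, ℝ) ∞ Δ U
  pos : ∀ x ∈ U, 0 < Δ x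
  kahler : IsKahlerOn (rescaleMetric Δ h) U
  ricciFlat : IsRicciFlatOn (rescaleMetric Δ h) U
  parallel : IsParallelOn (rescaleMetric Δ h) (rescaleForm Δ Ω) U

/-- `(M, h, Ω)` is a locally conformal Calabi-Yau manifold. -/
structure IsLocallyConformalCalabiYau {n : ℕ} (h : BilinField E M) (Ω : CForm E M n) : Prop where
  suStructure : IsSUStructure h Ω
  locally_conformal : ∀ x : M, ∃ (U : Set M) (Δ : M → ℝ), x ∈ U ∧ IsLocalFactor h Ω U Δ

/-- `φ` is the Lee form of `(M, h, Ω)`: a smooth closed `1`-form with `dω = φ ∧ ω` that is locally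
`-d log Δ` for the local conformal factors `Δ`. -/
structure IsLeeForm {n : ℕ} (h : BilinField E M) (Ω : CForm E M n) (φ : OneForm E M) : Prop where
  smooth : ∀ e ∈ atlas E M, ContDiffOn ℝ ∞ (φ.inChart e) e.target
  closed : ∀ e ∈ atlas E M, ∀ x ∈ e.source, ∀ u v : E, extDerivOne (φ.inChart e) (e x) u v = 0
  lee : ∀ e ∈ atlas E M, ∀ x ∈ e.source, ∀ u v w : E,
    extDerivTwo ((fundamentalForm h).inChart e) (e x) u v w =
      wedgeOneTwo (φ.inChart e (e x)) ((fundamentalForm h).inChart e (e x)) u v w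
  locally_factor : ∀ x : M, ∃ (U : Set M) (Δ : M → ℝ), x ∈ U ∧ IsLocalFactor h Ω U Δ ∧
    ∀ y ∈ U, φ y = -mvfderiv 𝓘(ℝ, E) (fun z => Real.log (Δ z)) y

/-- `V` is a vector field along the curve `γ`, parallel for the Levi-Civita connection of `h`:
in every chart, `V' + Γ(γ', V) = 0`. -/
structure IsParallelAlong (h : BilinField E M) (γ : ℝ → M) (V : ℝ → TangentBundle 𝓘(ℝ, E) M) :
    Prop where
  along : ∀ t, (V t).proj = γ t
  parallel : ∀ t, ∀ e ∈ atlas E M, γ t ∈ e.source →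
    HasDerivAt (fun s => (mfderiv 𝓘(ℝ, E) 𝓘(ℝ, E) e (V s).proj (V s).2 : E))
      (-christoffel (h.inChart e) (e (γ t)) (deriv (fun s => e (γ s)) t)
        (mfderiv 𝓘(ℝ, E) 𝓘(ℝ, E) e (V t).proj (V t).2 : E)) t

/-- The holonomy group of `h` at `x`: the parallel transports along the smooth loops at `x`.
(Loops need not be immersed, so corners of piecewise smooth loops are covered by
reparametrization.) -/
def holonomy (h : BilinField E M) (x : M) :
    Set (TangentSpace 𝓘(ℝ, E) x →L[ℝ] TangentSpace 𝓘(ℝ, E) x) :=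
  {A | ∃ γ : ℝ → M, ContMDiff 𝓘(ℝ, ℝ) 𝓘(ℝ, E) ∞ γ ∧ γ 0 = x ∧ γ 1 = x ∧
    ∀ v : TangentSpace 𝓘(ℝ, E) x, ∃ V : ℝ → TangentBundle 𝓘(ℝ, E) M,
      IsParallelAlong h γ V ∧ V 0 = ⟨x, v⟩ ∧ V 1 = ⟨x, A v⟩}

/-- The holonomy of `h` is contained in `SU(n)`: in a suitable isometric identification of each
tangent space with `ℂⁿ`, all holonomy transformations are special unitary matrices. -/
def HasHolonomyInSU (n : ℕ) (h : BilinField E M) : Prop :=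
  ∀ x : M, ∃ L : TangentSpace 𝓘(ℝ, E) x ≃L[ℝ] (Fin n → ℂ),
    (∀ v w, h x v w = (star (L v) ⬝ᵥ L w).re) ∧
    ∀ A ∈ holonomy h x, ∃ U ∈ Matrix.specialUnitaryGroup (Fin n) ℂ, ∀ v,
      L (A v) = U.mulVec (L v)

/-- `(M, h)` is a Calabi-Yau manifold of complex dimension `n`: `h` is a Kähler metric, the
canonical bundle is holomorphically trivial, and the holonomy is contained in `SU(n)`. -/
structure IsCalabiYau (n : ℕ) (h : BilinField E M) : Prop where
  kahler : IsKahlerOn h Set.univ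
  canonical_trivial : ∃ Ψ : CForm E M n, Ψ.IsHolomorphic ∧ ∀ x, Ψ x ≠ 0
  holonomy : HasHolonomyInSU n h

end Manifold

end LCCY

end

/-! Everything rests on the fact that d log Δ does not depend on the local factor Δ. Where Δg is
Kähler, its Christoffel symbols are complex-linear, so the parallel (n,0)-form Δ^(n/2) Ω satisfies
the Cauchy-Riemann equations (`IsLocalFactor.fderiv_I_smul`). By the product rule, (n/2) ∂̄(log Δ)
times Ω is then expressed through first derivatives of Ω alone (`IsLocalFactor.fderiv_log`). Since Ω
takes the value 1 at every point and log Δ is real, Ω determines d log Δ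
(`IsLocalFactor.mvfderiv_log_eq`). The local forms -d log Δ therefore agree on overlaps and give the
unique Lee form φ; the equation dω = φ ∧ ω is d(Δω) = 0 expanded.

On a simply connected manifold φ = df: the local primitives define a covering space with discrete
fibre ℝ, which has a section (`exists_primitive`). As f + log Δ has zero derivative, e^(-f) is
locally a constant multiple of Δ. Multiplying a metric by a constant changes neither its Levi-Civita
connection nor its Ricci tensor, so e^(-f) is a conformal factor on all of M (`isLocalFactor_univ`).

For the holonomy, parallel transport preserves the metric, J and Ω'. In an SU(n)-frame these become
the Euclidean product, multiplication by i and the determinant, so a loop gives a special unitary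
matrix (`exists_specialUnitary`). -/

namespace LCCY

/-! ### Levi-Civita calculus on a real vector space, and constant rescaling -/

section LocalLemmas

variable {E : Type*} [NormedAddCommGroup E] [NormedSpace ℝ E]

/-- `christoffel` uses `ContinuousLinearMap.inverse`, which is 0 on non-invertible maps;
definiteness excludes this default. -/
theorem isInvertible_of_pos [FiniteDimensional ℝ E] {B : E →L[ℝ] E →L[ℝ] ℝ} (hB : ∀ v, v ≠ 0 → 0 < B v v) :
    B.IsInvertible := by
  have hinj : Function.Injective (B : E →ₗ[ℝ] E →L[ℝ] ℝ) := by
    rw [← LinearMap.ker_eq_bot, LinearMap.ker_eq_bot']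
    intro v hv
    by_contra hne
    have h := hB v hne
    rw [show B v = 0 from hv] at h
    simp at h
  have hdim : Module.finrank ℝ E = Module.finrank ℝ (E →L[ℝ] ℝ) := by
    rw [← LinearMap.toContinuousLinearMap.finrank_eq, Module.finrank_linearMap]
    simp
  exact ⟨(LinearEquiv.ofInjectiveOfFinrankEq _ hinj hdim).toContinuousLinearEquiv, by ext; rfl⟩

/-- The defining property of the Christoffel symbols. -/
theorem christoffel_apply [FiniteDimensional ℝ E] {G : E → E →L[ℝ] E →L[ℝ] ℝ} {p : E}
    (hG : ∀ v, v ≠ 0 → 0 < G p v v) (u v w : E) :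
    G p (christoffel G p u v) w =
      (1 / 2 : ℝ) * (fderiv ℝ G p u v w + fderiv ℝ G p v u w - fderiv ℝ G p w u v) := by
  have h := (isInvertible_of_pos hG).self_apply_inverse
    (((1 / 2 : ℝ) • (fderiv ℝ G p + (fderiv ℝ G p).flip -
      ((ContinuousLinearMap.flipₗᵢ ℝ E E ℝ).toContinuousLinearEquiv :
      (E →L[ℝ] E →L[ℝ] ℝ) →L[ℝ] (E →L[ℝ] E →L[ℝ] ℝ)).comp (fderiv ℝ G p).flip)) u v)
  have h' := congrArg (fun l : E →L[ℝ] ℝ => l w) h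
  simpa [christoffel] using h'

theorem eq_of_pos {B : E →L[ℝ] E →L[ℝ] ℝ} (hB : ∀ v, v ≠ 0 → 0 < B v v) {a b : E}
    (h : ∀ w, B a w = B b w) : a = b := by
  by_contra hne
  have := hB (a - b) (sub_ne_zero.2 hne)
  simp only [map_sub, sub_apply, h] at this
  simp at this

theorem fderiv_apply₂ {G : E → E →L[ℝ] E →L[ℝ] ℝ} {p : E} (hd : DifferentiableAt ℝ G p)
    (u v w : E) : fderiv ℝ (fun q => G q v w) p u = fderiv ℝ G p u v w := by
  have h1 : HasFDerivAt (fun q => G q v w)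
      ((ContinuousLinearMap.apply ℝ ℝ w).comp
        ((ContinuousLinearMap.apply ℝ (E →L[ℝ] ℝ) v).comp (fderiv ℝ G p))) p :=
    (ContinuousLinearMap.apply ℝ ℝ w).hasFDerivAt.comp p
      ((ContinuousLinearMap.apply ℝ (E →L[ℝ] ℝ) v).hasFDerivAt.comp p hd.hasFDerivAt)
  rw [h1.fderiv]
  rfl

theorem fderiv_congr₂ {G H : E → E →L[ℝ] E →L[ℝ] ℝ} {p : E} (hd : DifferentiableAt ℝ G p)
    (hd' : DifferentiableAt ℝ H p) {v w v' w' : E} (h : ∀ᶠ q in 𝓝 p, G q v w = H q v' w')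
    (u : E) : fderiv ℝ G p u v w = fderiv ℝ H p u v' w' := by
  rw [← fderiv_apply₂ hd, ← fderiv_apply₂ hd', Filter.EventuallyEq.fderiv_eq h]

/-- A symmetric, positive definite, differentiable metric near `p`. -/
structure IsMetricNear (G : E → E →L[ℝ] E →L[ℝ] ℝ) (p : E) : Prop where
  diff : DifferentiableAt ℝ G p
  symm : ∀ᶠ q in 𝓝 p, ∀ v w, G q v w = G q w v
  pos : ∀ᶠ q in 𝓝 p, ∀ v, v ≠ 0 → 0 < G q v v

namespace IsMetricNear

variable {G : E → E →L[ℝ] E →L[ℝ] ℝ} {p : E}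

theorem fderiv_symm (hG : IsMetricNear G p) (u v w : E) : fderiv ℝ G p u v w = fderiv ℝ G p u w v :=
  fderiv_congr₂ hG.diff hG.diff (hG.symm.mono fun _ h => h v w) u

theorem christoffel_symm [FiniteDimensional ℝ E] (hG : IsMetricNear G p)
    (u v : E) : christoffel G p u v = christoffel G p v u := by
  refine eq_of_pos hG.pos.self_of_nhds fun w => ?_
  rw [christoffel_apply hG.pos.self_of_nhds, christoffel_apply hG.pos.self_of_nhds,
    hG.fderiv_symm w u v]
  ring

/-- The Levi-Civita connection is metric. -/
theorem fderiv_eq_christoffel [FiniteDimensional ℝ E] (hG : IsMetricNear G p)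
    (u v w : E) :
    fderiv ℝ G p u v w = G p (christoffel G p u v) w + G p v (christoffel G p u w) := by
  rw [hG.symm.self_of_nhds v, christoffel_apply hG.pos.self_of_nhds,
    christoffel_apply hG.pos.self_of_nhds, hG.fderiv_symm u w v, hG.fderiv_symm w u v,
    hG.fderiv_symm v u w]
  ring

end IsMetricNear

theorem christoffel_congr {G H : E → E →L[ℝ] E →L[ℝ] ℝ} {p : E} (h : G =ᶠ[𝓝 p] H) :
    christoffel G p = christoffel H p := by
  simp only [christoffel, h.fderiv_eq, h.eq_of_nhds]

/-- Both sides of the defining identity of Γ are linear in the metric, so a constant factor cancels.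
-/
theorem christoffel_const_smul [FiniteDimensional ℝ E] {G : E → E →L[ℝ] E →L[ℝ] ℝ} {c : ℝ} (hc : 0 < c) {p : E}
    (hG : ∀ v, v ≠ 0 → 0 < G p v v) :
    christoffel (fun q => c • G q) p = christoffel G p := by
  have hG' : ∀ v, v ≠ 0 → 0 < (c • G p) v v := fun v hv => by
    simpa using mul_pos hc (hG v hv)
  have hf : fderiv ℝ (fun q => c • G q) p = c • fderiv ℝ G p :=
    congrFun (fderiv_const_smul_field (𝕜 := ℝ) (f := G) c) p
  ext u v
  refine eq_of_pos hG fun w => ?_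
  have h1 := christoffel_apply (G := fun q => c • G q) hG' u v w
  have h2 := christoffel_apply hG u v w
  rw [hf] at h1
  simp only [smul_apply, smul_eq_mul] at h1
  apply mul_left_cancel₀ hc.ne'
  rw [h1, h2]
  ring

theorem christoffel_eventuallyEq_of_smul [FiniteDimensional ℝ E] {G H : E → E →L[ℝ] E →L[ℝ] ℝ} {c : ℝ} (hc : 0 < c)
    {p : E} (hG : ∀ᶠ q in 𝓝 p, ∀ v, v ≠ 0 → 0 < G q v v) (h : ∀ᶠ q in 𝓝 p, H q = c • G q) :
    christoffel H =ᶠ[𝓝 p] christoffel G := by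
  filter_upwards [hG, h.eventually_nhds] with q hq hq'
  rw [← christoffel_const_smul hc hq]
  exact christoffel_congr hq'

/-- Curvature is built from Γ alone, and the trace of an endomorphism needs no metric, so no power
of c appears. -/
theorem ricci_eq_of_smul [FiniteDimensional ℝ E] {G H : E → E →L[ℝ] E →L[ℝ] ℝ} {c : ℝ} (hc : 0 < c)
    {p : E} (hG : ∀ᶠ q in 𝓝 p, ∀ v, v ≠ 0 → 0 < G q v v) (h : ∀ᶠ q in 𝓝 p, H q = c • G q)
    (v w : E) : ricci H p v w = ricci G p v w := by
  have h1 := christoffel_eventuallyEq_of_smul hc hG h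
  simp only [ricci, curvature, h1.fderiv_eq, h1.eq_of_nhds]

theorem covDeriv_eq_of_smul [FiniteDimensional ℝ E] {n : ℕ} {G H : E → E →L[ℝ] E →L[ℝ] ℝ} {c : ℝ} (hc : 0 < c)
    {W X : E → E [⋀^Fin n]→L[ℝ] ℂ} {a : ℝ}
    {p : E} (hG : ∀ᶠ q in 𝓝 p, ∀ v, v ≠ 0 → 0 < G q v v) (h : ∀ᶠ q in 𝓝 p, H q = c • G q)
    (hX : ∀ᶠ q in 𝓝 p, X q = a • W q) (u : E) (v : Fin n → E) :
    covDeriv H X p u v = a • covDeriv G W p u v := by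
  have h1 := christoffel_eventuallyEq_of_smul hc hG h
  have hX' : X =ᶠ[𝓝 p] fun q => a • W q := hX
  have hf : fderiv ℝ X p = a • fderiv ℝ W p := by
    rw [hX'.fderiv_eq]
    exact congrFun (fderiv_const_smul_field (𝕜 := ℝ) (f := W) a) p
  simp only [covDeriv, h1.eq_of_nhds, hf, hX.self_of_nhds]
  simp [smul_sub, Finset.smul_sum]

end LocalLemmas

/-! ### Kähler metrics in complex coordinates -/

section LocalComplex

variable {E : Type*} [NormedAddCommGroup E] [NormedSpace ℂ E]

@[simp] theorem mulI_apply (v : E) : (mulI : E →L[ℝ] E) v = Complex.I • v := rfl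

/-- On a Kähler manifold, the Christoffel symbols are complex-linear. -/
theorem IsMetricNear.christoffel_mulI [FiniteDimensional ℝ E] {G : E → E →L[ℝ] E →L[ℝ] ℝ} {p : E}
    (hG : IsMetricNear G p)
    (hJ : ∀ᶠ q in 𝓝 p, ∀ v w, G q (Complex.I • v) (Complex.I • w) = G q v w)
    (hK : ∀ u v w, extDerivTwo (fun q => (G q).comp mulI) p u v w = 0) (u v : E) :
    christoffel G p u (Complex.I • v) = Complex.I • christoffel G p u v := by
  have hD : ∀ u v w, fderiv ℝ G p u (Complex.I • v) (Complex.I • w) = fderiv ℝ G p u v w :=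
    fun u v w => fderiv_congr₂ hG.diff hG.diff (hJ.mono fun _ h => h v w) u
  have hneg : ∀ v : E, Complex.I • Complex.I • v = -v := fun v => by
    rw [smul_smul, Complex.I_mul_I, neg_one_smul]
  have hD' : ∀ u v w, fderiv ℝ G p u v (Complex.I • w) = - fderiv ℝ G p u (Complex.I • v) w :=
    fun u v w => by
      rw [← hD u v (Complex.I • w), hneg]; simp
  have hJ' : ∀ v w, G p (Complex.I • v) w = - G p v (Complex.I • w) := fun v w => by
    rw [← hJ.self_of_nhds v (Complex.I • w), hneg]; simp
  have hω : DifferentiableAt ℝ (fun q => (G q).comp (mulI : E →L[ℝ] E)) p :=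
    hG.diff.clm_comp (differentiableAt_const _)
  have hdω : ∀ u v w, fderiv ℝ (fun q => (G q).comp (mulI : E →L[ℝ] E)) p u v w =
      fderiv ℝ G p u (Complex.I • v) w := fun u v w =>
    fderiv_congr₂ hω hG.diff (Filter.Eventually.of_forall fun q => rfl) u
  have hK' : ∀ u v w, fderiv ℝ G p u (Complex.I • v) w + fderiv ℝ G p v (Complex.I • w) u +
      fderiv ℝ G p w (Complex.I • u) v = 0 := fun u v w => by
    have := hK u v w
    simpa only [extDerivTwo, hdω] using this
  refine eq_of_pos hG.pos.self_of_nhds fun w => ?_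
  rw [hJ', christoffel_apply hG.pos.self_of_nhds, christoffel_apply hG.pos.self_of_nhds]
  -- The derivatives in direction u agree by J-invariance. The four remaining terms cancel by dω(v,
  -- w, u) + dω(iv, u, iw) = 0, a sum in which the u-derivatives drop out.
  have k1 := hK' v w u
  have k2 := hK' (Complex.I • v) u (Complex.I • w)
  have s := hG.fderiv_symm
  simp only [hneg, map_neg, neg_apply, hD, hD'] at k1 k2 ⊢
  linarith [s u v w, s u (Complex.I • v) w, s u (Complex.I • w) v, hD' u v w, hD' u w v,
    s w u (Complex.I • v), hD' w u v, hD' v u w, s v u (Complex.I • w), hD' v w u,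
    s (Complex.I • v) u w, s (Complex.I • w) u v]

/-- A parallel `(n, 0)`-form on a Kähler manifold satisfies the Cauchy-Riemann equations. -/
theorem IsMetricNear.fderiv_mulI_of_parallel [FiniteDimensional ℝ E] {n : ℕ} {G : E → E →L[ℝ] E →L[ℝ] ℝ} {p : E}
    (hG : IsMetricNear G p)
    (hJ : ∀ᶠ q in 𝓝 p, ∀ v w, G q (Complex.I • v) (Complex.I • w) = G q v w)
    (hK : ∀ u v w, extDerivTwo (fun q => (G q).comp mulI) p u v w = 0)
    {W : E → E [⋀^Fin n]→L[ℝ] ℂ}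
    (hW : ∀ (v : Fin n → E) i, W p (Function.update v i (Complex.I • v i)) = Complex.I * W p v)
    (hP : ∀ u v, covDeriv G W p u v = 0) (u : E) (v : Fin n → E) :
    fderiv ℝ W p (Complex.I • u) v = Complex.I * fderiv ℝ W p u v := by
  have h1 := sub_eq_zero.1 (hP u v)
  have h2 := sub_eq_zero.1 (hP (Complex.I • u) v)
  rw [h1, h2, Finset.mul_sum]
  refine Finset.sum_congr rfl fun i _ => ?_
  -- Symmetry of Γ moves i from the direction of differentiation into the complex-linear slot; type
  -- (n,0) then takes it out of W.
  rw [hG.christoffel_symm, hG.christoffel_mulI hJ hK, hG.christoffel_symm,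
    ← hW (Function.update v i _) i]
  simp

/-- A real-differentiable function satisfying the Cauchy-Riemann equations is
complex-differentiable. -/
theorem differentiableAt_complex_of_fderiv_mulI {F : Type*} [NormedAddCommGroup F]
    [NormedSpace ℂ F] {f : E → F} {p : E} (hf : DifferentiableAt ℝ f p)
    (h : ∀ u, fderiv ℝ f p (Complex.I • u) = Complex.I • fderiv ℝ f p u) :
    DifferentiableAt ℂ f p := by
  rw [differentiableAt_iff_restrictScalars ℝ hf]
  refine ⟨{ toFun := fderiv ℝ f p, map_add' := by simp, map_smul' := fun c u => ?_,
            cont := (fderiv ℝ f p).cont }, rfl⟩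
  rw [RingHom.id_apply]
  conv_lhs => rw [← Complex.re_add_im c]
  conv_rhs => rw [← Complex.re_add_im c]
  simp only [add_smul, map_add, mul_smul, h, Complex.coe_smul, map_smul]

end LocalComplex

/-! ### Tensors read in holomorphic charts -/

section Charts

variable {E : Type*} [NormedAddCommGroup E] [NormedSpace ℂ E]
  {M : Type*} [TopologicalSpace M] [ChartedSpace E M]
  {e : OpenPartialHomeomorph M E}

theorem BilinField.inChart_rescale (D : M → ℝ) (h : BilinField E M) (p : E) :
    BilinField.inChart (rescaleMetric D h) e p = D (e.symm p) • h.inChart e p := rfl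

theorem CForm.inChart_rescale {n : ℕ} (D : M → ℝ) (Ω : CForm E M n) (p : E) :
    CForm.inChart (rescaleForm D Ω) e p = (Real.sqrt (D (e.symm p)) ^ n) • Ω.inChart e p := rfl

theorem hasMFDerivAt_restrictScalars {f : E → M} {p : E} {f' : E →L[ℂ] E}
    (h : HasMFDerivAt 𝓘(ℂ, E) 𝓘(ℂ, E) f p f') :
    HasMFDerivAt 𝓘(ℝ, E) 𝓘(ℝ, E) f p (f'.restrictScalars ℝ) :=
  ⟨h.1, HasFDerivWithinAt.restrictScalars ℝ h.2⟩

/-- The derivative of the inverse of a chart, as an endomorphism of the model space. -/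
noncomputable def chartMap (e : OpenPartialHomeomorph M E) (p : E) : E →L[ℝ] E := chartFrame e p

variable [IsManifold 𝓘(ℂ, E) ω M]

theorem mem_maximalAtlas_real (he : e ∈ atlas E M) :
    e ∈ IsManifold.maximalAtlas 𝓘(ℝ, E) ∞ M :=
  IsManifold.subset_maximalAtlas he

theorem mdifferentiable_real (he : e ∈ atlas E M) : e.MDifferentiable 𝓘(ℝ, E) 𝓘(ℝ, E) :=
  mdifferentiable_of_mem_atlas he

theorem contMDiffOn_symm_real (he : e ∈ atlas E M) :
    ContMDiffOn 𝓘(ℝ, E) 𝓘(ℝ, E) ∞ e.symm e.target :=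
  contMDiffOn_symm_of_mem_maximalAtlas (mem_maximalAtlas_real he)

/-- Charts are holomorphic, so the real derivative is the restriction of a complex-linear map. Hence
J, defined through the model space, is multiplication by i in every chart. -/
theorem chartMap_I_smul (he : e ∈ atlas E M) {p : E} (hp : p ∈ e.target) (v : E) :
    chartMap e p (Complex.I • v) = Complex.I • chartMap e p v := by
  have h := (mdifferentiable_of_mem_atlas (I := 𝓘(ℂ, E)) he).mdifferentiableAt_symm hp
  obtain ⟨f', hf'⟩ : ∃ f' : E →L[ℂ] E, HasMFDerivAt 𝓘(ℂ, E) 𝓘(ℂ, E) e.symm p f' :=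
    ⟨_, h.hasMFDerivAt⟩
  have h' : chartMap e p = f'.restrictScalars ℝ := (hasMFDerivAt_restrictScalars hf').mfderiv
  rw [h']
  exact f'.map_smul Complex.I v

theorem chartFrame_bijective (he : e ∈ atlas E M) {p : E} (hp : p ∈ e.target) :
    Function.Bijective (chartFrame e p) :=
  (mdifferentiable_real he).symm.mfderiv_bijective hp

theorem chartFrame_mfderiv (he : e ∈ atlas E M) {x : M} (hx : x ∈ e.source)
    (v : TangentSpace 𝓘(ℝ, E) x) :
    (chartFrame e (e x) (mfderiv 𝓘(ℝ, E) 𝓘(ℝ, E) e x v) : E) = v :=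
  congrArg (fun l => l v) ((mdifferentiable_real he).symm_comp_deriv hx)

theorem BilinField.inChart_mfderiv (h : BilinField E M) (he : e ∈ atlas E M) {x : M}
    (hx : x ∈ e.source) (v w : TangentSpace 𝓘(ℝ, E) x) :
    h.inChart e (e x) (mfderiv 𝓘(ℝ, E) 𝓘(ℝ, E) e x v) (mfderiv 𝓘(ℝ, E) 𝓘(ℝ, E) e x w) =
      h x v w := by
  -- The base point `e.symm (e x)` is only propositionally equal to x, so the comparison takes place
  -- in the model space E.
  have key : ∀ y, y = x → ∀ a b a' b' : E, a = a' → b = b' →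
    (h y : E →L[ℝ] E →L[ℝ] ℝ) a b = (h x : E →L[ℝ] E →L[ℝ] ℝ) a' b' := by
    rintro _ rfl _ _ _ _ rfl rfl; rfl
  exact key _ (e.left_inv hx) _ _ _ _ (chartFrame_mfderiv he hx v) (chartFrame_mfderiv he hx w)

theorem OneForm.inChart_mfderiv (φ : OneForm E M) (he : e ∈ atlas E M) {x : M}
    (hx : x ∈ e.source) (v : TangentSpace 𝓘(ℝ, E) x) :
    φ.inChart e (e x) (mfderiv 𝓘(ℝ, E) 𝓘(ℝ, E) e x v) = φ x v := by
  have key : ∀ y, y = x → ∀ a a' : E, a = a' →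
    (φ y : E →L[ℝ] ℝ) a = (φ x : E →L[ℝ] ℝ) a' := by
    rintro _ rfl _ _ rfl; rfl
  exact key _ (e.left_inv hx) _ _ (chartFrame_mfderiv he hx v)

theorem CForm.inChart_mfderiv {n : ℕ} (Ω : CForm E M n) (he : e ∈ atlas E M) {x : M}
    (hx : x ∈ e.source) (v : Fin n → TangentSpace 𝓘(ℝ, E) x) :
    Ω.inChart e (e x) (fun i => mfderiv 𝓘(ℝ, E) 𝓘(ℝ, E) e x (v i)) = Ω x v := by
  have key : ∀ y, y = x → ∀ a a' : Fin n → E, a = a' →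
    (Ω y : E [⋀^Fin n]→L[ℝ] ℂ) a = (Ω x : E [⋀^Fin n]→L[ℝ] ℂ) a' := by
    rintro _ rfl _ _ rfl; rfl
  exact key _ (e.left_inv hx) _ _ (funext fun i => chartFrame_mfderiv he hx (v i))

theorem OneForm.inChart_mvfderiv {f : M → ℝ} (he : e ∈ atlas E M) {p : E} (hp : p ∈ e.target)
    (hf : MDifferentiableAt 𝓘(ℝ, E) 𝓘(ℝ, ℝ) f (e.symm p)) :
    OneForm.inChart (fun x : M => mvfderiv 𝓘(ℝ, E) f x) e p = fderiv ℝ (f ∘ e.symm) p := by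
  have h := mvfderiv_comp p hf ((mdifferentiable_real he).mdifferentiableAt_symm hp)
  have h2 : mvfderiv 𝓘(ℝ, E) (f ∘ e.symm) p = fderiv ℝ (f ∘ e.symm) p := by
    rw [mvfderiv, mfderiv_eq_fderiv]; rfl
  rw [← h2, h]
  rfl

theorem BilinField.inChart_fundamentalForm (h : BilinField E M) (he : e ∈ atlas E M) {p : E}
    (hp : p ∈ e.target) :
    (fundamentalForm h).inChart e p = (h.inChart e p).comp mulI := by
  ext v w
  exact congrArg (fun a : E => (h (e.symm p) : E →L[ℝ] E →L[ℝ] ℝ) a (chartMap e p w))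
    (chartMap_I_smul he hp v).symm

variable [FiniteDimensional ℂ E]

theorem contDiffOn_inChart_metric (g : Metric E M) (he : e ∈ atlas E M) :
    ContDiffOn ℝ ∞ (BilinField.inChart g.inner e) e.target := by
  have hs := contMDiffOn_symm_real he
  have hv : ∀ v : E, ContMDiffOn 𝓘(ℝ, E) 𝓘(ℝ, E).tangent ∞
      (fun p => (⟨e.symm p, chartFrame e p v⟩ : TangentBundle 𝓘(ℝ, E) M)) e.target := by
    intro v
    have h1 := hs.contMDiffOn_tangentMapWithin (m := ∞) le_rfl e.open_target.uniqueMDiffOn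
    -- The frame field is the tangent map of `e.symm` applied to a constant vector field on E.
    have h2 : ContMDiff 𝓘(ℝ, E) 𝓘(ℝ, E).tangent ∞
        (fun p : E => (⟨p, v⟩ : TangentBundle 𝓘(ℝ, E) E)) := by
      exact contMDiff_vectorSpace_iff_contDiff.2 (contDiff_const (c := v))
    refine (h1.comp h2.contMDiffOn fun p hp => hp).congr fun p hp => ?_
    simp only [Function.comp, tangentMapWithin]
    rw [mfderivWithin_of_isOpen e.open_target hp]
    rfl
  rw [contDiffOn_clm_apply]
  intro v
  rw [contDiffOn_clm_apply]
  intro w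
  have h := ContMDiffOn.clm_bundle_apply₂ (F₁ := E) (F₂ := E) (F₃ := ℝ)
    (E₃ := Bundle.Trivial M ℝ)
    (ψ := fun p => g.inner (e.symm p)) (b := fun p => e.symm p)
    (g.contMDiff.comp_contMDiffOn hs) (hv v) (hv w)
  rw [← contMDiffOn_iff_contDiffOn]
  intro p hp
  have := h p hp
  simp only [Bundle.contMDiffWithinAt_totalSpace] at this
  exact this.2

end Charts

/-! ### Gluing local primitives on simply connected spaces -/

/-- On a simply connected space, functions that are locally given up to locally constant
functions can be glued to a global function. -/
theorem exists_forall_eventually_sub_eq {X A : Type*} [TopologicalSpace X]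
    [SimplyConnectedSpace X] [LocallyPathConnectedSpace X] [AddCommGroup A]
    (U : X → Set X) (hU : ∀ i, IsOpen (U i)) (hmem : ∀ i, i ∈ U i) (F : X → X → A)
    (hF : ∀ i j, ∀ x ∈ U i ∩ U j, ∀ᶠ y in 𝓝 x, F i y - F j y = F i x - F j x) :
    ∃ f : X → A, ∀ i, ∀ x ∈ U i, ∀ᶠ y in 𝓝 x, f y - F i y = f x - F i x := by
  -- Over U i the fibre coordinate stands for f - F i, so the transition from i to j adds F i - F j.
  -- This is locally constant, hence continuous into the discrete group A, and the bundle is a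
  -- covering.
  let : TopologicalSpace A := ⊥
  have : DiscreteTopology A := ⟨rfl⟩
  let Z : FiberBundleCore X X A :=
    { baseSet := U
      isOpen_baseSet := hU
      indexAt := id
      mem_baseSet_at := hmem
      coordChange := fun i j x t => t + (F i x - F j x)
      coordChange_self := fun i x _ t => by simp
      continuousOn_coordChange := fun i j => by
        have h1 : ContinuousOn (fun p : X × A => F i p.1 - F j p.1)
            ((U i ∩ U j) ×ˢ Set.univ) := by
          have : ContinuousOn (fun x => F i x - F j x) (U i ∩ U j) := fun x hx =>
            ContinuousAt.continuousWithinAt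
              (tendsto_nhds_of_eventually_eq (hF i j x hx))
          exact this.comp continuousOn_fst fun p hp => hp.1
        have h2 : Continuous fun q : A × A => q.1 + q.2 := continuous_of_discreteTopology
        exact h2.comp_continuousOn (continuousOn_snd.prodMk h1)
      coordChange_comp := fun i j k x _ t => by abel }
  obtain ⟨x₀⟩ : Nonempty X := inferInstance
  -- A lift of the identity map is a global section; it exists because X is simply connected.
  obtain ⟨s, ⟨-, hs⟩, -⟩ :=
    (FiberBundle.isCoveringMap (F := A) (E := Z.Fiber)).existsUnique_continuousMap_lifts
      (ContinuousMap.id X) x₀ ⟨x₀, (0 : A)⟩ rfl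
  have hs' : ∀ x, (s x).1 = x := fun x => congrFun hs x
  let t : X → A := fun x => (s x).2
  -- The fibre over x carries the coordinate of index x, so the section there is f x - F x x.
  refine ⟨fun x => F (s x).1 (s x).1 + t x, fun i x hx => ?_⟩
  have key : ∀ y, F (s y).1 (s y).1 + t y - F i y = (Z.localTriv i (s y)).2 := fun y => by
    rw [Z.localTriv_apply]
    change _ = t y + (F (s y).1 (s y).1 - F i (s y).1)
    rw [hs' y]
    abel
  have hcont : ContinuousAt (fun y => (Z.localTriv i (s y)).2) x := by
    have h1 : s x ∈ (Z.localTriv i).source := by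
      rw [Z.mem_localTriv_source, hs' x]; exact hx
    exact continuousAt_snd.comp
      (((Z.localTriv i).continuousAt h1).comp s.continuous.continuousAt)
  simp only [key]
  -- A continuous map into a discrete space is locally constant.
  have h2 := hcont.tendsto
  rw [nhds_discrete A] at h2
  exact Filter.tendsto_pure.1 h2

section Primitive

variable {E : Type*} [NormedAddCommGroup E] [NormedSpace ℝ E]
  {M : Type*} [TopologicalSpace M] [ChartedSpace E M]

/-- A function with vanishing derivative is locally constant. -/
theorem eventually_eq_of_mvfderiv_eq_zero {F : M → ℝ} {U : Set M} (hU : IsOpen U)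
    (hF : MDifferentiableOn 𝓘(ℝ, E) 𝓘(ℝ, ℝ) F U)
    (hF' : ∀ x ∈ U, mvfderiv 𝓘(ℝ, E) F x = 0) [IsManifold 𝓘(ℝ, E) ∞ M] {x : M} (hx : x ∈ U) :
    ∀ᶠ y in 𝓝 x, F y = F x := by
  set e := chartAt E x
  have hxe : x ∈ e.source := mem_chart_source E x
  have he : e.MDifferentiable 𝓘(ℝ, E) 𝓘(ℝ, E) :=
    mdifferentiable_of_mem_atlas (chart_mem_atlas E x)
  have hopen : IsOpen (e.target ∩ e.symm ⁻¹' U) := e.isOpen_inter_preimage_symm hU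
  have hmem : e x ∈ e.target ∩ e.symm ⁻¹' U :=
    ⟨e.map_source hxe, by rw [Set.mem_preimage, e.left_inv hxe]; exact hx⟩
  obtain ⟨r, hr, hball⟩ := Metric.isOpen_iff.1 hopen _ hmem
  have hd : ∀ p ∈ Metric.ball (e x) r, HasFDerivAt (F ∘ e.symm) (0 : E →L[ℝ] ℝ) p := by
    intro p hp
    have hpU := hball hp
    have h1 : MDifferentiableAt 𝓘(ℝ, E) 𝓘(ℝ, ℝ) F (e.symm p) :=
      (hF _ hpU.2).mdifferentiableAt (hU.mem_nhds hpU.2)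
    have h2 := he.mdifferentiableAt_symm hpU.1
    have h3 : mvfderiv 𝓘(ℝ, E) (F ∘ e.symm) p = 0 := by
      rw [mvfderiv_comp p h1 h2, hF' _ hpU.2]; rfl
    have h4 : mvfderiv 𝓘(ℝ, E) (F ∘ e.symm) p = fderiv ℝ (F ∘ e.symm) p := by
      rw [mvfderiv, mfderiv_eq_fderiv]; rfl
    rw [← show fderiv ℝ (F ∘ e.symm) p = (0 : E →L[ℝ] ℝ) from h4.symm.trans h3]
    exact (mdifferentiableAt_iff_differentiableAt.1 (h1.comp p h2)).hasFDerivAt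
  have hnhds : ∀ᶠ y in 𝓝 x, y ∈ e.source ∧ e y ∈ Metric.ball (e x) r :=
    Filter.Eventually.and (e.open_source.mem_nhds hxe) ((e.continuousAt hxe).eventually (Metric.ball_mem_nhds _ hr))
  filter_upwards [hnhds] with y hy
  have := (convex_ball (e x) r).is_const_of_fderivWithin_eq_zero (𝕜 := ℝ) (f := F ∘ e.symm)
    (fun p hp => (hd p hp).differentiableAt.differentiableWithinAt)
    (fun p hp => by
      rw [fderivWithin_of_isOpen Metric.isOpen_ball hp, (hd p hp).fderiv])
    hy.2 (Metric.mem_ball_self hr)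
  simpa [e.left_inv hy.1, e.left_inv hxe] using this

/-- On a simply connected manifold, a `1`-form that locally has primitives has a global one. -/
theorem exists_primitive [IsManifold 𝓘(ℝ, E) ∞ M] [SimplyConnectedSpace M]
    (φ : ∀ x : M, TangentSpace 𝓘(ℝ, E) x →L[ℝ] ℝ)
    (hφ : ∀ x : M, ∃ (U : Set M) (F : M → ℝ), IsOpen U ∧ x ∈ U ∧
      ContMDiffOn 𝓘(ℝ, E) 𝓘(ℝ, ℝ) ∞ F U ∧ ∀ y ∈ U, φ y = mvfderiv 𝓘(ℝ, E) F y) :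
    ∃ f : M → ℝ, ContMDiff 𝓘(ℝ, E) 𝓘(ℝ, ℝ) ∞ f ∧ ∀ x, φ x = mvfderiv 𝓘(ℝ, E) f x := by
  choose U F hU hmem hF hφF using hφ
  have : LocallyPathConnectedSpace M := ChartedSpace.locallyPathConnectedSpace E M
  have hdiff : ∀ i, ∀ x ∈ U i, MDifferentiableAt 𝓘(ℝ, E) 𝓘(ℝ, ℝ) (F i) x := fun i x hx =>
    ((hF i).contMDiffAt ((hU i).mem_nhds hx)).mdifferentiableAt (by simp)
  obtain ⟨f, hf⟩ := exists_forall_eventually_sub_eq U hU hmem F fun i j x hx => by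
    refine eventually_eq_of_mvfderiv_eq_zero (E := E) (F := fun y => F i y - F j y)
      ((hU i).inter (hU j)) (fun y hy => ?_) (fun y hy => ?_) hx
    · exact ((hdiff i y hy.1).sub (hdiff j y hy.2)).mdifferentiableWithinAt
    · rw [mvfderiv_fun_sub (hdiff i y hy.1) (hdiff j y hy.2), ← hφF i y hy.1, ← hφF j y hy.2,
        sub_self]
  have hloc : ∀ x, f =ᶠ[𝓝 x] fun y => F x y + (f x - F x x) := fun x => by
    filter_upwards [hf x x (hmem x)] with y hy
    rw [← hy]; ring
  refine ⟨f, fun x => ?_, fun x => ?_⟩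
  · have h1 : ContMDiffAt 𝓘(ℝ, E) 𝓘(ℝ, ℝ) ∞ (fun y => F x y + (f x - F x x)) x :=
      ((hF x).contMDiffAt ((hU x).mem_nhds (hmem x))).add contMDiffAt_const
    exact h1.congr_of_eventuallyEq (hloc x)
  · have h2 : mvfderiv 𝓘(ℝ, E) f x = mvfderiv 𝓘(ℝ, E) (fun y => F x y + (f x - F x x)) x := by
      have := (hloc x).mfderiv_eq (I := 𝓘(ℝ, E)) (I' := 𝓘(ℝ, ℝ))
      ext v
      exact congrArg (fun l : E →L[ℝ] ℝ => l v) this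
    rw [h2, mvfderiv_fun_add (hdiff x x (hmem x)) (mdifferentiableAt_const),
      mvfderiv_const, add_zero]
    exact hφF x x (hmem x)

end Primitive

/-! ### Pointwise algebra of SU(n)-structures -/

section SUStructure

variable {E : Type*} [NormedAddCommGroup E] [NormedSpace ℂ E]
  {M : Type*} [TopologicalSpace M] [ChartedSpace E M] {n : ℕ}
  {h : BilinField E M} {Ω : CForm E M n}

/-- In a frame Ω is the determinant, and applying J to one argument multiplies one row by i. -/
theorem IsSUStructure.typeN0 (hS : IsSUStructure h Ω) : Ω.IsTypeN0 := by
  intro x v i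
  obtain ⟨L, hJ, -, hΩ⟩ := hS.frame x
  set A : Matrix (Fin n) (Fin n) ℂ := Matrix.of fun i j => L (v i) j
  have h1 : (Matrix.of fun k j => L (Function.update v i (J x (v i)) k) j) =
      A.updateRow i (Complex.I • A i) := by
    ext j k
    by_cases hj : j = i
    · subst hj; simp [A, hJ, Matrix.updateRow_apply]
    · simp [A, hj, Matrix.updateRow_apply]
  rw [hΩ, hΩ, h1, Matrix.det_updateRow_smul, Matrix.updateRow_eq_self]

theorem IsSUStructure.exists_apply_eq_one (hS : IsSUStructure h Ω) (x : M) :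
    ∃ v, Ω x v = 1 := by
  obtain ⟨L, -, -, hΩ⟩ := hS.frame x
  refine ⟨fun i => L.symm (Pi.single i 1), ?_⟩
  rw [hΩ, ← Matrix.det_one (n := Fin n)]
  congr 1
  ext i j
  simp [Matrix.one_apply, Pi.single_apply, eq_comm]

end SUStructure

/-! ### Ω determines d log Δ -/

section Factor

theorem eventually_symm_mem {E M : Type*} [TopologicalSpace E] [TopologicalSpace M]
    {e : OpenPartialHomeomorph M E} {U : Set M} (hU : IsOpen U) {p : E} (hp : p ∈ e.target)
    (hpU : e.symm p ∈ U) : ∀ᶠ q in 𝓝 p, q ∈ e.target ∧ e.symm q ∈ U :=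
  (e.isOpen_inter_preimage_symm hU).mem_nhds ⟨hp, hpU⟩

variable {E : Type*} [NormedAddCommGroup E] [NormedSpace ℂ E]
  {M : Type*} [TopologicalSpace M] [ChartedSpace E M]
  {e : OpenPartialHomeomorph M E}

theorem extDerivTwo_congr {B B' : E → E →L[ℝ] E →L[ℝ] ℝ} {p : E} (hB : B =ᶠ[𝓝 p] B')
    (u v w : E) : extDerivTwo B p u v w = extDerivTwo B' p u v w := by
  simp only [extDerivTwo, hB.fderiv_eq]

variable [IsManifold 𝓘(ℂ, E) ω M]

theorem fundamentalForm_inChart_eventuallyEq (h : BilinField E M) (he : e ∈ atlas E M) {p : E}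
    (hp : p ∈ e.target) :
    (fundamentalForm h).inChart e =ᶠ[𝓝 p] fun q => (h.inChart e q).comp mulI := by
  filter_upwards [e.open_target.mem_nhds hp] with q hq
  exact h.inChart_fundamentalForm he hq

theorem contDiffAt_comp_symm (he : e ∈ atlas E M) {p : E} (hp : p ∈ e.target) {f : M → ℝ}
    (hf : ContMDiffAt 𝓘(ℝ, E) 𝓘(ℝ, ℝ) ∞ f (e.symm p)) : ContDiffAt ℝ ∞ (f ∘ e.symm) p :=
  contMDiffAt_iff_contDiffAt.1
    (hf.comp p ((contMDiffOn_symm_real he).contMDiffAt (e.open_target.mem_nhds hp)))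

theorem CForm.IsTypeN0.inChart {n : ℕ} {Ω : CForm E M n} (hΩ : Ω.IsTypeN0) (he : e ∈ atlas E M)
    {p : E} (hp : p ∈ e.target) (v : Fin n → E) (i : Fin n) :
    Ω.inChart e p (Function.update v i (Complex.I • v i)) = Complex.I * Ω.inChart e p v := by
  refine Eq.trans ?_ (hΩ (e.symm p) (fun j => chartMap e p (v j)) i)
  refine congrArg (Ω (e.symm p) : E [⋀^Fin n]→L[ℝ] ℂ) (funext fun j => ?_)
  by_cases hj : j = i
  · subst hj
    refine Eq.trans ?_ (Function.update_self (β := fun _ => E) j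
      (Complex.I • chartMap e p (v j)) fun j => chartMap e p (v j)).symm
    change chartMap e p _ = _
    rw [Function.update_self, chartMap_I_smul he hp]
  · refine Eq.trans ?_ (Function.update_of_ne (β := fun _ => E) hj
      (Complex.I • chartMap e p (v i)) fun j => chartMap e p (v j)).symm
    change chartMap e p _ = _
    rw [Function.update_of_ne hj]

variable {n : ℕ} {g : Metric E M} {Ω : CForm E M n}
  {U : Set M} {D : M → ℝ}

theorem metric_inChart_pos (g : Metric E M) (he : e ∈ atlas E M) {p : E} (hp : p ∈ e.target)
    (v : E) (hv : v ≠ 0) : 0 < BilinField.inChart g.inner e p v v :=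
  g.pos (e.symm p) (chartFrame e p v) fun h0 =>
    hv ((chartFrame_bijective he hp).1 (h0.trans (map_zero (chartFrame e p)).symm))

theorem isMetricNear_inChart [FiniteDimensional ℂ E] (he : e ∈ atlas E M) (hU : IsOpen U)
    (hD : ContMDiffOn 𝓘(ℝ, E) 𝓘(ℝ, ℝ) ∞ D U) (hpos : ∀ x ∈ U, 0 < D x) {p : E}
    (hp : p ∈ e.target) (hpU : e.symm p ∈ U) :
    IsMetricNear (BilinField.inChart (rescaleMetric D g.inner) e) p where
  diff := by
    have h1 := contDiffAt_comp_symm he hp (hD.contMDiffAt (hU.mem_nhds hpU))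
    have h2 := (contDiffOn_inChart_metric g he).contDiffAt (e.open_target.mem_nhds hp)
    exact (h1.smul h2).differentiableAt (by simp)
  symm := Filter.Eventually.of_forall fun q v w =>
    congrArg (D (e.symm q) * ·) (g.symm (e.symm q) (chartFrame e q v) (chartFrame e q w))
  pos := by
    filter_upwards [eventually_symm_mem hU hp hpU] with q hq v hv
    exact mul_pos (hpos _ hq.2) (metric_inChart_pos g he hq.1 v hv)

namespace IsLocalFactor

theorem isMetricNear [FiniteDimensional ℂ E] (hF : IsLocalFactor g.inner Ω U D) (he : e ∈ atlas E M) {p : E}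
    (hp : p ∈ e.target) (hpU : e.symm p ∈ U) :
    IsMetricNear (BilinField.inChart (rescaleMetric D g.inner) e) p :=
  isMetricNear_inChart he hF.isOpen hF.smooth hF.pos hp hpU

theorem inChart_I_smul (hF : IsLocalFactor g.inner Ω U D) (he : e ∈ atlas E M) {p : E}
    (hp : p ∈ e.target) (hpU : e.symm p ∈ U) (v w : E) :
    BilinField.inChart (rescaleMetric D g.inner) e p (Complex.I • v) (Complex.I • w) =
      BilinField.inChart (rescaleMetric D g.inner) e p v w := by
  have h1 := hF.kahler.hermitian _ hpU (chartMap e p v) (chartMap e p w)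
  exact Eq.trans (congrArg₂ (fun a b : E => (rescaleMetric D g.inner (e.symm p) :
    E →L[ℝ] E →L[ℝ] ℝ) a b) (chartMap_I_smul he hp v) (chartMap_I_smul he hp w)) h1

theorem extDerivTwo_eq_zero (hF : IsLocalFactor g.inner Ω U D) (he : e ∈ atlas E M) {p : E}
    (hp : p ∈ e.target) (hpU : e.symm p ∈ U) (u v w : E) :
    extDerivTwo (fun q => (BilinField.inChart (rescaleMetric D g.inner) e q).comp mulI)
      p u v w = 0 := by
  have h1 := hF.kahler.closed e he (e.symm p) ⟨e.map_target hp, hpU⟩ u v w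
  rw [e.right_inv hp] at h1
  rw [← h1]
  exact (extDerivTwo_congr (fundamentalForm_inChart_eventuallyEq _ he hp) u v w).symm

theorem christoffel_I_smul [FiniteDimensional ℂ E] (hF : IsLocalFactor g.inner Ω U D) (he : e ∈ atlas E M) {p : E}
    (hp : p ∈ e.target) (hpU : e.symm p ∈ U) (u v : E) :
    christoffel (BilinField.inChart (rescaleMetric D g.inner) e) p u (Complex.I • v) =
      Complex.I • christoffel (BilinField.inChart (rescaleMetric D g.inner) e) p u v :=
  (hF.isMetricNear he hp hpU).christoffel_mulI
    ((eventually_symm_mem hF.isOpen hp hpU).mono fun _ hq => hF.inChart_I_smul he hq.1 hq.2)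
    (hF.extDerivTwo_eq_zero he hp hpU) u v

/-- The Cauchy-Riemann equations for the rescaled form. -/
theorem fderiv_I_smul [FiniteDimensional ℂ E] (hF : IsLocalFactor g.inner Ω U D) (hΩ : Ω.IsTypeN0)
    (he : e ∈ atlas E M) {p : E}
    (hp : p ∈ e.target) (hpU : e.symm p ∈ U) (u : E) (v : Fin n → E) :
    fderiv ℝ (CForm.inChart (rescaleForm D Ω) e) p (Complex.I • u) v =
      Complex.I * fderiv ℝ (CForm.inChart (rescaleForm D Ω) e) p u v := by
  refine (hF.isMetricNear he hp hpU).fderiv_mulI_of_parallel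
    ((eventually_symm_mem hF.isOpen hp hpU).mono fun _ hq => hF.inChart_I_smul he hq.1 hq.2)
    (hF.extDerivTwo_eq_zero he hp hpU) (fun v i => ?_) (fun u v => ?_) u v
  · simp only [CForm.inChart_rescale, ContinuousAlternatingMap.smul_apply, hΩ.inChart he hp]
    rw [mul_smul_comm]
  · have h1 := hF.parallel e he (e.symm p) ⟨e.map_target hp, hpU⟩ u v
    rwa [e.right_inv hp] at h1

theorem contDiffAt_log (hF : IsLocalFactor g.inner Ω U D) (he : e ∈ atlas E M) {p : E}
    (hp : p ∈ e.target) (hpU : e.symm p ∈ U) :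
    ContDiffAt ℝ ∞ (fun q => Real.log (D (e.symm q))) p :=
  (contDiffAt_comp_symm he hp (hF.smooth.contMDiffAt (hF.isOpen.mem_nhds hpU))).log
    (hF.pos _ hpU).ne'

theorem contMDiffOn_log (hF : IsLocalFactor g.inner Ω U D) :
    ContMDiffOn 𝓘(ℝ, E) 𝓘(ℝ, ℝ) ∞ (fun z => Real.log (D z)) U := fun z hz =>
  (Real.contDiffAt_log.2 (hF.pos z hz).ne').contMDiffAt.comp_contMDiffWithinAt z
    (hF.smooth z hz)

/-- The form `Ω` determines the `(0, 1)`-part of the logarithmic derivative of a local factor. -/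
theorem fderiv_log [FiniteDimensional ℂ E] (hF : IsLocalFactor g.inner Ω U D) (hS : IsSUStructure g.inner Ω)
    (he : e ∈ atlas E M) {p : E}
    (hp : p ∈ e.target) (hpU : e.symm p ∈ U) (u : E) (v : Fin n → E) :
    (n / 2 : ℝ) * (Complex.I * fderiv ℝ (fun q => Real.log (D (e.symm q))) p u -
      fderiv ℝ (fun q => Real.log (D (e.symm q))) p (Complex.I • u)) * Ω.inChart e p v =
    fderiv ℝ (Ω.inChart e) p (Complex.I • u) v - Complex.I * fderiv ℝ (Ω.inChart e) p u v := by
  have hl := ((hF.contDiffAt_log he hp hpU).differentiableAt (by simp)).hasFDerivAt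
  set l' := fderiv ℝ (fun q => Real.log (D (e.symm q))) p
  have hW := (((hS.smooth e he).contDiffAt (e.open_target.mem_nhds hp)).differentiableAt
    (by simp)).hasFDerivAt
  have hs := ((hl.const_mul (n / 2 : ℝ)).exp).smul hW
  -- Writing √Δ^n as exp((n/2) log Δ) brings out d log Δ on differentiation.
  have heq : CForm.inChart (rescaleForm D Ω) e =ᶠ[𝓝 p]
      fun q => Real.exp (n / 2 * Real.log (D (e.symm q))) • Ω.inChart e q := by
    filter_upwards [eventually_symm_mem hF.isOpen hp hpU] with q hq
    rw [CForm.inChart_rescale, Real.sqrt_eq_rpow, ← Real.rpow_natCast, ← Real.rpow_mul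
      (hF.pos _ hq.2).le, Real.rpow_def_of_pos (hF.pos _ hq.2)]
    congr 2
    ring
  have hX := (hs.congr_of_eventuallyEq heq).fderiv
  have hCR := hF.fderiv_I_smul hS.typeN0 he hp hpU u v
  rw [hX] at hCR
  have hpos := Real.exp_pos (n / 2 * Real.log (D (e.symm p)))
  set s := Real.exp (n / 2 * Real.log (D (e.symm p)))
  have hs0 : (s : ℂ) ≠ 0 := by exact_mod_cast hpos.ne'
  simp at hCR
  apply mul_left_cancel₀ hs0
  push_cast
  linear_combination -hCR

/-- Comparison through Ω rather than ω also covers n = 1, where every 2-form is closed and the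
Kähler condition says nothing about Δ. -/
theorem mvfderiv_log_eq [FiniteDimensional ℂ E] (hn : Module.finrank ℂ E = n) {U' : Set M} {D' : M → ℝ}
    (hS : IsSUStructure g.inner Ω)
    (hF : IsLocalFactor g.inner Ω U D) (hF' : IsLocalFactor g.inner Ω U' D') {x : M}
    (hx : x ∈ U) (hx' : x ∈ U') :
    mvfderiv 𝓘(ℝ, E) (fun z => Real.log (D z)) x =
      mvfderiv 𝓘(ℝ, E) (fun z => Real.log (D' z)) x := by
  have hsymm : (chartAt E x).symm (chartAt E x x) = x :=
    (chartAt E x).left_inv (mem_chart_source E x)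
  have he := chart_mem_atlas E x
  have hp := mem_chart_target E x
  have hxs := mem_chart_source E x
  set e := chartAt E x
  have hd : ∀ {V : Set M} {D₁ : M → ℝ}, IsLocalFactor g.inner Ω V D₁ → x ∈ V →
      MDifferentiableAt 𝓘(ℝ, E) 𝓘(ℝ, ℝ) (fun z => Real.log (D₁ z)) x := by
    intro V D₁ hV hxV
    exact ((hV.contMDiffOn_log x hxV).contMDiffAt (hV.isOpen.mem_nhds hxV)).mdifferentiableAt
      (by simp)
  have hc : ∀ {V : Set M} {D₁ : M → ℝ}, IsLocalFactor g.inner Ω V D₁ → x ∈ V → ∀ v,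
      mvfderiv 𝓘(ℝ, E) (fun z => Real.log (D₁ z)) x v =
      fderiv ℝ (fun q => Real.log (D₁ (e.symm q))) (e x) (mfderiv 𝓘(ℝ, E) 𝓘(ℝ, E) e x v) := by
    intro V D₁ hV hxV v
    have h1 := OneForm.inChart_mvfderiv (f := fun z => Real.log (D₁ z)) he hp
      (by rw [hsymm]; exact hd hV hxV)
    have h2 := OneForm.inChart_mfderiv (fun z : M => mvfderiv 𝓘(ℝ, E) (fun z => Real.log (D₁ z)) z)
      he hxs v
    rw [h1] at h2
    exact h2.symm
  ext v
  rw [hc hF hx, hc hF' hx']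
  generalize (mfderiv 𝓘(ℝ, E) 𝓘(ℝ, E) e x v : E) = u
  -- For n = 0 the coefficient n/2 vanishes, but so does every tangent vector.
  rcases Nat.eq_zero_or_pos n with rfl | hn0
  · have := Module.finrank_zero_iff.1 hn
    rw [show u = (0 : E) from Subsingleton.elim (α := E) u 0]
    exact (map_zero _).trans (map_zero _).symm
  · obtain ⟨v₀, hv₀⟩ := hS.exists_apply_eq_one x
    rw [← CForm.inChart_mfderiv Ω he hxs] at hv₀
    have h1 := hF.fderiv_log hS he hp (hsymm.symm ▸ hx) u
      (fun i => mfderiv 𝓘(ℝ, E) 𝓘(ℝ, E) e x (v₀ i))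
    have h2 := hF'.fderiv_log hS he hp (hsymm.symm ▸ hx') u
      (fun i => mfderiv 𝓘(ℝ, E) 𝓘(ℝ, E) e x (v₀ i))
    rw [← h2] at h1
    have hn' : ((n / 2 : ℝ) : ℂ) ≠ 0 := by
      exact_mod_cast (by positivity : (n / 2 : ℝ) ≠ 0)
    -- The imaginary part of i·ℓ(u) - ℓ(iu), with ℓ = d log Δ real, is ℓ(u).
    have h3 := congrArg Complex.im
      (mul_left_cancel₀ hn' (mul_right_cancel₀ (hv₀.symm ▸ one_ne_zero) h1))
    simpa using h3

end IsLocalFactor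

end Factor

/-! ### The Lee form and global conformal factors -/

section Lee

variable {E : Type*} [NormedAddCommGroup E] [NormedSpace ℂ E]
  {M : Type*} [TopologicalSpace M] [ChartedSpace E M] [IsManifold 𝓘(ℂ, E) ω M]
  {e : OpenPartialHomeomorph M E} {n : ℕ} {g : Metric E M} {Ω : CForm E M n}
  {U : Set M} {D : M → ℝ}

namespace IsLocalFactor

/-- The equation `dω = -d log Δ ∧ ω` for a local factor `Δ`. -/
theorem extDerivTwo_fundamentalForm [FiniteDimensional ℂ E] (hF : IsLocalFactor g.inner Ω U D)
    (he : e ∈ atlas E M) {p : E} (hp : p ∈ e.target) (hpU : e.symm p ∈ U) (u v w : E) :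
    extDerivTwo ((fundamentalForm g.inner).inChart e) p u v w =
      wedgeOneTwo (-fderiv ℝ (fun q => Real.log (D (e.symm q))) p)
        ((fundamentalForm g.inner).inChart e p) u v w := by
  have hB := fundamentalForm_inChart_eventuallyEq g.inner he hp
  rw [extDerivTwo_congr hB, hB.eq_of_nhds]
  have hG := ((contDiffOn_inChart_metric g he).contDiffAt
    (e.open_target.mem_nhds hp)).differentiableAt (by simp)
  have hω : DifferentiableAt ℝ (fun q => (BilinField.inChart g.inner e q).comp
      (mulI : E →L[ℝ] E)) p := hG.clm_comp (differentiableAt_const _)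
  have hδ : DifferentiableAt ℝ (fun q => D (e.symm q)) p :=
    (contDiffAt_comp_symm he hp
      (hF.smooth.contMDiffAt (hF.isOpen.mem_nhds hpU))).differentiableAt (by simp)
  have hpos := hF.pos _ hpU
  have h0 := hF.extDerivTwo_eq_zero he hp hpU u v w
  have hd := (hδ.hasFDerivAt.smul hω.hasFDerivAt).fderiv
  -- Expanding d(Δω) = 0 gives dΔ ∧ ω + Δ dω = 0, which is then divided by Δ.
  change extDerivTwo ((fun q => D (e.symm q)) • fun q =>
    (BilinField.inChart g.inner e q).comp (mulI : E →L[ℝ] E)) p u v w = 0 at h0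
  rw [(hδ.hasFDerivAt.log hpos.ne').fderiv]
  simp only [extDerivTwo, hd] at h0
  simp only [extDerivTwo, wedgeOneTwo, neg_apply, smul_apply, smul_eq_mul, add_apply,
    ContinuousLinearMap.smulRight_apply] at h0 ⊢
  field_simp
  linear_combination h0

end IsLocalFactor

theorem OneForm.inChart_eq_of_factor (hF : IsLocalFactor g.inner Ω U D) {φ : OneForm E M}
    (hφ : ∀ y ∈ U, φ y = -mvfderiv 𝓘(ℝ, E) (fun z => Real.log (D z)) y)
    (he : e ∈ atlas E M) {p : E} (hp : p ∈ e.target) (hpU : e.symm p ∈ U) :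
    φ.inChart e p = -fderiv ℝ (fun q => Real.log (D (e.symm q))) p := by
  have h1 := OneForm.inChart_mvfderiv (f := fun z => Real.log (D z)) he hp
    ((hF.contMDiffOn_log.contMDiffAt (hF.isOpen.mem_nhds hpU)).mdifferentiableAt (by simp))
  change _ = -fderiv ℝ ((fun z => Real.log (D z)) ∘ e.symm) p
  rw [← h1]
  simp only [OneForm.inChart, hφ _ hpU]
  rfl

/-- The remaining conditions are local: closedness is symmetry of the second derivative of log Δ,
and the Lee equation comes from d(Δω) = 0. -/
theorem isLeeForm_of_locally_factor [FiniteDimensional ℂ E] {φ : OneForm E M}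
    (hφ : ∀ x : M, ∃ (U : Set M) (Δ : M → ℝ), x ∈ U ∧ IsLocalFactor g.inner Ω U Δ ∧
      ∀ y ∈ U, φ y = -mvfderiv 𝓘(ℝ, E) (fun z => Real.log (Δ z)) y) :
    IsLeeForm g.inner Ω φ := by
  have hev : ∀ e ∈ atlas E M, ∀ p ∈ e.target, ∃ ℓ : E → ℝ, ContDiffAt ℝ ∞ ℓ p ∧
      φ.inChart e =ᶠ[𝓝 p] fun q => -fderiv ℝ ℓ q := by
    intro e he p hp
    obtain ⟨U, D, hx, hF, hφU⟩ := hφ (e.symm p)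
    refine ⟨_, hF.contDiffAt_log he hp hx, ?_⟩
    filter_upwards [eventually_symm_mem hF.isOpen hp hx] with q hq
    exact OneForm.inChart_eq_of_factor hF hφU he hq.1 hq.2
  refine ⟨fun e he p hp => ?_, fun e he x hx u v => ?_, fun e he x hx u v w => ?_, hφ⟩
  · obtain ⟨ℓ, hℓ, heq⟩ := hev e he p hp
    exact ((hℓ.fderiv_right (m := ∞) (by simp)).neg.congr_of_eventuallyEq heq).contDiffWithinAt
  · obtain ⟨ℓ, hℓ, heq⟩ := hev e he (e x) (e.map_source hx)
    have hsymm : IsSymmSndFDerivAt ℝ ℓ (e x) :=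
      hℓ.isSymmSndFDerivAt (by
        rw [minSmoothness_of_isRCLikeNormedField]; exact WithTop.coe_le_coe.2 le_top)
    have h2 : fderiv ℝ (φ.inChart e) (e x) = -fderiv ℝ (fderiv ℝ ℓ) (e x) := by
      rw [heq.fderiv_eq, fderiv_fun_neg]
    simp only [extDerivOne, h2, neg_apply, hsymm u v, sub_self]
  · obtain ⟨U, D, hxU, hF, hφU⟩ := hφ x
    have hp := e.map_source hx
    have hpU : e.symm (e x) ∈ U := (e.left_inv hx).symm ▸ hxU
    rw [OneForm.inChart_eq_of_factor hF hφU he hp hpU]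
    exact hF.extDerivTwo_fundamentalForm he hp hpU u v w

/-- Uniqueness comes from the local form -d log Δ; for n = 1 the equation dω = φ ∧ ω is vacuous. -/
theorem IsLocallyConformalCalabiYau.existsUnique_isLeeForm [FiniteDimensional ℂ E]
    (hn : Module.finrank ℂ E = n) (h : IsLocallyConformalCalabiYau g.inner Ω) :
    ∃! φ : OneForm E M, IsLeeForm g.inner Ω φ := by
  choose U D hmem hF using h.locally_conformal
  refine ⟨fun x => -mvfderiv 𝓘(ℝ, E) (fun z => Real.log (D x z)) x, ?_, fun φ hφ => ?_⟩
  · exact isLeeForm_of_locally_factor fun x => ⟨U x, D x, hmem x, hF x, fun y hy => congrArg (-·)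
      (IsLocalFactor.mvfderiv_log_eq hn h.suStructure (hF y) (hF x) (hmem y) hy)⟩
  · funext x
    obtain ⟨U', D', hx, hF', hφ'⟩ := hφ.locally_factor x
    rw [hφ' x hx, IsLocalFactor.mvfderiv_log_eq hn h.suStructure hF' (hF x) hx (hmem x)]

/-- A function that is locally a constant multiple of local factors is a global factor. -/
theorem isLocalFactor_univ [FiniteDimensional ℂ E] (hD : ContMDiff 𝓘(ℝ, E) 𝓘(ℝ, ℝ) ∞ D)
    (hpos : ∀ x, 0 < D x)
    (hloc : ∀ x, ∃ (U : Set M) (Δ : M → ℝ) (c : ℝ), 0 < c ∧ x ∈ U ∧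
      IsLocalFactor g.inner Ω U Δ ∧ ∀ᶠ y in 𝓝 x, D y = c * Δ y) :
    IsLocalFactor g.inner Ω Set.univ D := by
  have hchart : ∀ e ∈ atlas E M, ∀ x ∈ e.source, ∃ (U : Set M) (Δ : M → ℝ) (c : ℝ), 0 < c ∧
      x ∈ U ∧ IsLocalFactor g.inner Ω U Δ ∧ e.symm (e x) ∈ U ∧ e x ∈ e.target ∧
      ∀ᶠ q in 𝓝 (e x), D (e.symm q) = c * Δ (e.symm q) := by
    intro e he x hx
    obtain ⟨U, Δ, c, hc, hxU, hF, hev⟩ := hloc x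
    exact ⟨U, Δ, c, hc, hxU, hF, (e.left_inv hx).symm ▸ hxU, e.map_source hx,
      (e.tendsto_symm hx).eventually hev⟩
  have hsmul : ∀ (e : OpenPartialHomeomorph M E) {Δ : M → ℝ} {c : ℝ} {p : E},
      (∀ᶠ q in 𝓝 p, D (e.symm q) = c * Δ (e.symm q)) →
      ∀ᶠ q in 𝓝 p, BilinField.inChart (rescaleMetric D g.inner) e q =
        c • BilinField.inChart (rescaleMetric Δ g.inner) e q := fun e Δ c p hev =>
    hev.mono fun q hq => by
      rw [BilinField.inChart_rescale, BilinField.inChart_rescale, hq, mul_smul]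
  refine ⟨isOpen_univ, hD.contMDiffOn, fun x _ => hpos x, ⟨fun x _ v w => ?_,
    fun e he x hx u v w => ?_⟩, fun e he x hx v w => ?_, fun e he x hx u v => ?_⟩
  · obtain ⟨U, Δ, c, hc, hxU, hF, hev⟩ := hloc x
    have h1 : Δ x * _ = Δ x * _ := hF.kahler.hermitian x hxU v w
    exact congrArg (D x * ·) (mul_left_cancel₀ (hF.pos x hxU).ne' h1)
  · obtain ⟨U, Δ, c, hc, hxU, hF, hpU, hp, hev⟩ := hchart e he x hx.1
    rw [extDerivTwo_congr (fundamentalForm_inChart_eventuallyEq _ he hp)]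
    have h1 := hF.extDerivTwo_eq_zero he hp hpU u v w
    set B := fun q => (BilinField.inChart (rescaleMetric Δ g.inner) e q).comp (mulI : E →L[ℝ] E)
    have h2 : (fun q => (BilinField.inChart (rescaleMetric D g.inner) e q).comp
        (mulI : E →L[ℝ] E)) =ᶠ[𝓝 (e x)] c • B := (hsmul e hev).mono fun q hq => by
      simp only [hq]; rfl
    rw [extDerivTwo_congr h2]
    simp only [extDerivTwo, fderiv_const_smul_field, Pi.smul_apply, smul_apply, smul_eq_mul]
      at h1 ⊢
    linear_combination c * h1
  · obtain ⟨U, Δ, c, hc, hxU, hF, hpU, hp, hev⟩ := hchart e he x hx.1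
    rw [ricci_eq_of_smul hc (hF.isMetricNear he hp hpU).pos (hsmul e hev)]
    exact hF.ricciFlat e he x ⟨hx.1, hxU⟩ v w
  · obtain ⟨U, Δ, c, hc, hxU, hF, hpU, hp, hev⟩ := hchart e he x hx.1
    -- Scaling the factor by c scales the form by c^(n/2), again a constant.
    rw [covDeriv_eq_of_smul (a := Real.sqrt c ^ n) (W := CForm.inChart (rescaleForm Δ Ω) e)
      hc (hF.isMetricNear he hp hpU).pos (hsmul e hev)
      (hev.mono fun q hq => by
        rw [CForm.inChart_rescale, CForm.inChart_rescale, hq, Real.sqrt_mul hc.le, mul_pow,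
          mul_smul]), hF.parallel e he x ⟨hx.1, hxU⟩ u v, smul_zero]

theorem IsLocalFactor.isHolomorphic [FiniteDimensional ℂ E] (hS : IsSUStructure g.inner Ω)
    (hF : IsLocalFactor g.inner Ω Set.univ D)
    (hS' : IsSUStructure (rescaleMetric D g.inner) (rescaleForm D Ω)) :
    (rescaleForm D Ω).IsHolomorphic := by
  refine ⟨hS'.typeN0, fun e he v p hp => DifferentiableAt.differentiableWithinAt ?_⟩
  have hW := (((hS'.smooth e he).contDiffAt (e.open_target.mem_nhds hp)).differentiableAt
    (by simp)).hasFDerivAt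
  have hWv : HasFDerivAt (fun q => CForm.inChart (rescaleForm D Ω) e q v)
      ((ContinuousAlternatingMap.apply ℝ E ℂ v).comp
        (fderiv ℝ (CForm.inChart (rescaleForm D Ω) e) p)) p :=
    (ContinuousAlternatingMap.apply ℝ E ℂ v).hasFDerivAt.comp p hW
  refine differentiableAt_complex_of_fderiv_mulI hWv.differentiableAt fun u => ?_
  rw [hWv.fderiv]
  exact hF.fderiv_I_smul hS.typeN0 he hp (Set.mem_univ _) u v

end Lee

/-! ### Conformal rescaling of SU(n)-structures -/

section Rescale

variable {E : Type*} [NormedAddCommGroup E] [NormedSpace ℂ E]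
  {M : Type*} [TopologicalSpace M] [ChartedSpace E M] [IsManifold 𝓘(ℂ, E) ω M]

/-- A conformal rescaling of a Riemannian metric. -/
noncomputable def Metric.rescale (g : Metric E M) (D : M → ℝ)
    (hD : ContMDiff 𝓘(ℝ, E) 𝓘(ℝ, ℝ) ∞ D) (hpos : ∀ x, 0 < D x) : Metric E M where
  inner := rescaleMetric D g.inner
  symm x v w := congrArg (D x * ·) (g.symm x v w)
  pos x v hv := mul_pos (hpos x) (g.pos x v hv)
  isVonNBounded x := by
    have hs : 0 < Real.sqrt (D x) := Real.sqrt_pos.2 (hpos x)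
    -- The unit ball of Dg lies in the image of the unit ball of g under multiplication by D^(-1/2).
    refine ((g.isVonNBounded x).image ((Real.sqrt (D x))⁻¹ •
      ContinuousLinearMap.id ℝ (TangentSpace 𝓘(ℝ, E) x))).subset fun v hv => ?_
    refine ⟨Real.sqrt (D x) • v, ?_, ?_⟩
    · have hv' : D x * g.inner x v v < 1 := hv
      simp only [Set.mem_ofPred_eq, map_smul, smul_apply, smul_eq_mul]
      rwa [← mul_assoc, Real.mul_self_sqrt (hpos x).le]
    · simp only [smul_apply, ContinuousLinearMap.id_apply]
      exact inv_smul_smul₀ hs.ne' v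
  contMDiff := hD.smul_section g.contMDiff

theorem IsSUStructure.rescale {n : ℕ} {h : BilinField E M} {Ω : CForm E M n}
    (hS : IsSUStructure h Ω) {D : M → ℝ} (hD : ContMDiff 𝓘(ℝ, E) 𝓘(ℝ, ℝ) ∞ D)
    (hpos : ∀ x, 0 < D x) : IsSUStructure (rescaleMetric D h) (rescaleForm D Ω) where
  smooth e he p hp := by
    have h1 := ((contDiffAt_comp_symm he hp hD.contMDiffAt).sqrt (hpos _).ne').pow n
    have h2 := (hS.smooth e he).contDiffAt (e.open_target.mem_nhds hp)
    exact (h1.smul h2).contDiffWithinAt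
  frame x := by
    obtain ⟨L, hJ, hh, hΩ⟩ := hS.frame x
    have hs : 0 < Real.sqrt (D x) := Real.sqrt_pos.2 (hpos x)
    -- Scaling the frame by √D multiplies the inner product by D and the determinant by √D^n.
    refine ⟨L.trans (ContinuousLinearEquiv.smulLeft (Units.mk0 _ hs.ne')), fun v => ?_,
      fun v w => ?_, fun v => ?_⟩
    · change Real.sqrt (D x) • L (J x v) = Complex.I • Real.sqrt (D x) • L v
      rw [hJ, smul_comm]
    · change D x * h x v w =
        (star (Real.sqrt (D x) • L v) ⬝ᵥ (Real.sqrt (D x) • L w)).re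
      rw [hh, star_smul, smul_dotProduct, dotProduct_smul, smul_smul,
        star_trivial (Real.sqrt (D x)), Real.mul_self_sqrt (hpos x).le, Complex.real_smul, Complex.re_ofReal_mul]
    · change Real.sqrt (D x) ^ n • Ω x v =
        Matrix.det ((Real.sqrt (D x) : ℝ) • Matrix.of fun i j => L (v i) j)
      rw [hΩ, Matrix.det_smul_of_tower, Fintype.card_fin]

end Rescale

/-! ### Parallel transport and holonomy -/

section Holonomy

variable {E : Type*} [NormedAddCommGroup E] [NormedSpace ℂ E]
  {M : Type*} [TopologicalSpace M] [ChartedSpace E M]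

/-- The value of a field of bilinear forms at a point, on the model space. -/
def BilinField.toModel (h : BilinField E M) (x : M) : E →L[ℝ] E →L[ℝ] ℝ := h x

/-- The value of a form at a point, on the model space. -/
def CForm.toModel {n : ℕ} (Ω : CForm E M n) (x : M) : E [⋀^Fin n]→L[ℝ] ℂ := Ω x

/-- The vector part of a tangent vector, in the model space. -/
def vectorPart (V : TangentBundle 𝓘(ℝ, E) M) : E := V.2

/-- A tangent vector, read in a chart. -/
noncomputable def chartPart (e : OpenPartialHomeomorph M E) (V : TangentBundle 𝓘(ℝ, E) M) : E :=
  mfderiv 𝓘(ℝ, E) 𝓘(ℝ, E) e V.proj V.2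

variable [IsManifold 𝓘(ℂ, E) ω M] {e : OpenPartialHomeomorph M E}

theorem chartMap_chartPart (he : e ∈ atlas E M) {V : TangentBundle 𝓘(ℝ, E) M} {x : M}
    (hV : V.proj = x) (hx : x ∈ e.source) : chartMap e (e x) (chartPart e V) = vectorPart V := by
  subst hV
  exact chartFrame_mfderiv he hx V.2

theorem BilinField.toModel_apply (h : BilinField E M) (he : e ∈ atlas E M) {x : M}
    (hx : x ∈ e.source) {V W : TangentBundle 𝓘(ℝ, E) M} (hV : V.proj = x) (hW : W.proj = x) :
    h.toModel x (vectorPart V) (vectorPart W) =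
      h.inChart e (e x) (chartPart e V) (chartPart e W) := by
  rw [← chartMap_chartPart he hV hx, ← chartMap_chartPart he hW hx]
  change _ = h.toModel (e.symm (e x)) (chartMap e (e x) _) (chartMap e (e x) _)
  rw [e.left_inv hx]

theorem CForm.toModel_apply {n : ℕ} (Ω : CForm E M n) (he : e ∈ atlas E M) {x : M}
    (hx : x ∈ e.source) {V : Fin n → TangentBundle 𝓘(ℝ, E) M} (hV : ∀ i, (V i).proj = x) :
    Ω.toModel x (fun i => vectorPart (V i)) =
      Ω.inChart e (e x) (fun i => chartPart e (V i)) := by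
  simp only [← chartMap_chartPart he (hV _) hx]
  change _ = Ω.toModel (e.symm (e x)) (fun i => chartMap e (e x) (chartPart e (V i)))
  rw [e.left_inv hx]

theorem hasDerivAt_chart_comp {γ : ℝ → M} (hγ : ContMDiff 𝓘(ℝ, ℝ) 𝓘(ℝ, E) ∞ γ)
    (he : e ∈ atlas E M) {t : ℝ} (ht : γ t ∈ e.source) :
    HasDerivAt (fun s => e (γ s)) (deriv (fun s => e (γ s)) t) t := by
  have h1 := ((mdifferentiable_real he).mdifferentiableAt ht).comp t
    ((hγ t).mdifferentiableAt (by simp))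
  exact (mdifferentiableAt_iff_differentiableAt.1 h1).hasDerivAt

variable {n : ℕ} {g : Metric E M} {Ω : CForm E M n} {D : M → ℝ}

/-- Parallel transport preserves a parallel form. -/
theorem IsLocalFactor.hasDerivAt_form (hF : IsLocalFactor g.inner Ω Set.univ D)
    (hS : IsSUStructure (rescaleMetric D g.inner) (rescaleForm D Ω)) {γ : ℝ → M}
    (hγ : ContMDiff 𝓘(ℝ, ℝ) 𝓘(ℝ, E) ∞ γ) {V : Fin n → ℝ → TangentBundle 𝓘(ℝ, E) M}
    (hV : ∀ i, IsParallelAlong (rescaleMetric D g.inner) γ (V i)) (t : ℝ) :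
    HasDerivAt (fun s => CForm.toModel (rescaleForm D Ω) (γ s)
      (fun i => vectorPart (V i s))) 0 t := by
  have he := chart_mem_atlas E (γ t)
  have ht := mem_chart_source E (γ t)
  set e := chartAt E (γ t)
  have hV' : ∀ i, HasDerivAt (fun s => chartPart e (V i s)) _ t := fun i =>
    (hV i).parallel t e he ht
  have hΩ := (((hS.smooth e he).contDiffAt
    (e.open_target.mem_nhds (e.map_source ht))).differentiableAt (by simp)).hasFDerivAt
  have hΩc := hΩ.comp_hasDerivAt t (hasDerivAt_chart_comp hγ he ht)
  -- By the product rule and V' = -Γ(γ', V), the derivative along γ is the covariant derivative of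
  -- the form in direction γ'.
  have hd := (hΩc.hasFDerivAt.continuousAlternatingMap_apply
    fun i => (hV' i).hasFDerivAt).hasDerivAt
  have h0 := hF.parallel e he (γ t) ⟨ht, Set.mem_univ _⟩ (deriv (fun s => e (γ s)) t)
    (fun i => chartPart e (V i t))
  have heq : (fun s => CForm.toModel (rescaleForm D Ω) (γ s) (fun i => vectorPart (V i s)))
      =ᶠ[𝓝 t] fun s =>
      CForm.inChart (rescaleForm D Ω) e (e (γ s)) (fun i => chartPart e (V i s)) := by
    filter_upwards [hγ.continuous.continuousAt.eventually (e.open_source.mem_nhds ht)] with s hs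
    exact CForm.toModel_apply _ he hs fun i => (hV i).along s
  refine (hd.congr_of_eventuallyEq heq).congr_deriv ?_
  rw [covDeriv] at h0
  rw [← h0]
  simp [sub_eq_add_neg, chartPart]
  rfl

variable [FiniteDimensional ℂ E]

/-- Parallel transport preserves the metric. -/
theorem IsLocalFactor.hasDerivAt_metric (hF : IsLocalFactor g.inner Ω Set.univ D) {γ : ℝ → M}
    (hγ : ContMDiff 𝓘(ℝ, ℝ) 𝓘(ℝ, E) ∞ γ) {V W : ℝ → TangentBundle 𝓘(ℝ, E) M}
    (hV : IsParallelAlong (rescaleMetric D g.inner) γ V)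
    (hW : IsParallelAlong (rescaleMetric D g.inner) γ W) (t : ℝ) :
    HasDerivAt (fun s => BilinField.toModel (rescaleMetric D g.inner) (γ s)
      (vectorPart (V s)) (vectorPart (W s))) 0 t := by
  have he := chart_mem_atlas E (γ t)
  have ht := mem_chart_source E (γ t)
  set e := chartAt E (γ t)
  have hG := hF.isMetricNear he (e.map_source ht) (Set.mem_univ _)
  have hV' : HasDerivAt (fun s => chartPart e (V s)) _ t := hV.parallel t e he ht
  have hW' : HasDerivAt (fun s => chartPart e (W s)) _ t := hW.parallel t e he ht
  have hGc := hG.diff.hasFDerivAt.comp_hasDerivAt t (hasDerivAt_chart_comp hγ he ht)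
  have hd := (hGc.clm_apply hV').clm_apply hW'
  have h0 := hG.fderiv_eq_christoffel (deriv (fun s => e (γ s)) t) (chartPart e (V t))
    (chartPart e (W t))
  have heq : (fun s => BilinField.toModel (rescaleMetric D g.inner) (γ s)
      (vectorPart (V s)) (vectorPart (W s))) =ᶠ[𝓝 t] fun s =>
      (BilinField.inChart (rescaleMetric D g.inner) e (e (γ s))) (chartPart e (V s))
        (chartPart e (W s)) := by
    filter_upwards [hγ.continuous.continuousAt.eventually (e.open_source.mem_nhds ht)] with s hs
    exact BilinField.toModel_apply _ he hs (hV.along s) (hW.along s)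
  refine (hd.congr_of_eventuallyEq heq).congr_deriv ?_
  simp only [Function.comp_apply, map_neg, add_apply, neg_apply]
  rw [h0]
  simp only [chartPart]
  ring

/-- The complex structure of a Kähler manifold is parallel. -/
theorem IsLocalFactor.isParallelAlong_J (hF : IsLocalFactor g.inner Ω Set.univ D) {γ : ℝ → M}
    (hγ : ContMDiff 𝓘(ℝ, ℝ) 𝓘(ℝ, E) ∞ γ) {V : ℝ → TangentBundle 𝓘(ℝ, E) M}
    (hV : IsParallelAlong (rescaleMetric D g.inner) γ V) :
    IsParallelAlong (rescaleMetric D g.inner) γ (fun s => ⟨(V s).proj, J _ (V s).2⟩) := by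
  refine ⟨hV.along, fun t e he ht => ?_⟩
  have hI : ∀ U : TangentBundle 𝓘(ℝ, E) M, U.proj ∈ e.source →
      chartPart e ⟨U.proj, J _ U.2⟩ = Complex.I • chartPart e U := fun U hU => by
    apply (chartFrame_bijective he (e.map_source hU)).1
    change chartMap e (e U.proj) _ = chartMap e (e U.proj) _
    rw [chartMap_I_smul he (e.map_source hU), chartMap_chartPart he rfl hU,
      chartMap_chartPart (V := ⟨U.proj, J _ U.2⟩) he rfl hU]
    rfl
  have hd : HasDerivAt (fun s => chartPart e (V s)) _ t := hV.parallel t e he ht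
  have heq : (fun s => chartPart e ⟨(V s).proj, J _ (V s).2⟩) =ᶠ[𝓝 t]
      fun s => Complex.I • chartPart e (V s) := by
    filter_upwards [hγ.continuous.continuousAt.eventually (e.open_source.mem_nhds ht)] with s hs
    exact hI (V s) (hV.along s ▸ hs)
  have hd' := (hd.const_smul Complex.I).congr_of_eventuallyEq heq
  refine hd'.congr_deriv ?_
  change Complex.I • -(christoffel _ (e (γ t)) _ (chartPart e (V t))) =
    -christoffel _ (e (γ t)) _ (chartPart e ⟨(V t).proj, J _ (V t).2⟩)
  -- The transport equation is preserved by i because Γ is complex-linear in its second slot.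
  rw [hI (V t) (hV.along t ▸ ht),
    hF.christoffel_I_smul he (e.map_source ht) (Set.mem_univ _), smul_neg]

theorem eq_of_forall_hasDerivAt_zero {F : Type*} [NormedAddCommGroup F] [NormedSpace ℝ F]
    {f : ℝ → F} (hf : ∀ t, HasDerivAt f 0 t) (s t : ℝ) : f s = f t :=
  is_const_of_deriv_eq_zero (fun t => (hf t).differentiableAt) (fun t => (hf t).deriv) s t

theorem IsLocalFactor.holonomy_preserves_metric (hF : IsLocalFactor g.inner Ω Set.univ D) {x : M}
    {γ : ℝ → M} (hγ : ContMDiff 𝓘(ℝ, ℝ) 𝓘(ℝ, E) ∞ γ) (h0 : γ 0 = x) (h1 : γ 1 = x)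
    {V W : ℝ → TangentBundle 𝓘(ℝ, E) M}
    (hV : IsParallelAlong (rescaleMetric D g.inner) γ V)
    (hW : IsParallelAlong (rescaleMetric D g.inner) γ W) :
    BilinField.toModel (rescaleMetric D g.inner) x (vectorPart (V 1)) (vectorPart (W 1)) =
    BilinField.toModel (rescaleMetric D g.inner) x (vectorPart (V 0)) (vectorPart (W 0)) := by
  have h := eq_of_forall_hasDerivAt_zero (hF.hasDerivAt_metric hγ hV hW) 1 0
  simpa only [h0, h1] using h

/-- Real-linear automorphisms of `ℂⁿ` that commute with `i`, preserve the Euclidean inner product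
and the complex determinant are special unitary. -/
theorem exists_specialUnitary {n : ℕ} (B : (Fin n → ℂ) →ₗ[ℝ] (Fin n → ℂ))
    (hI : ∀ z, B (Complex.I • z) = Complex.I • B z)
    (hB : ∀ z w, (star (B z) ⬝ᵥ B w).re = (star z ⬝ᵥ w).re)
    (hdet : (Matrix.of fun i j => B (Pi.single i 1) j).det = 1) :
    ∃ U ∈ Matrix.specialUnitaryGroup (Fin n) ℂ, ∀ z, B z = U.mulVec z := by
  let C : (Fin n → ℂ) →ₗ[ℂ] (Fin n → ℂ) :=
    { toFun := B
      map_add' := B.map_add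
      map_smul' := fun c z => by
        rw [RingHom.id_apply]
        conv_lhs => rw [← Complex.re_add_im c]
        conv_rhs => rw [← Complex.re_add_im c]
        simp only [add_smul, map_add, mul_smul, hI, Complex.coe_smul, map_smul] }
  have hC : ∀ z, B z = (LinearMap.toMatrix' C).mulVec z := fun z =>
    (LinearMap.toMatrix'_mulVec C z).symm
  have hinner : ∀ z w, star (B z) ⬝ᵥ B w = star z ⬝ᵥ w := fun z w => by
    refine Complex.ext (hB z w) ?_
    -- Replacing w by iw turns the real part into minus the imaginary part.
    have h := hB z (Complex.I • w)
    rw [hI, dotProduct_smul, dotProduct_smul] at h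
    simpa using h
  refine ⟨LinearMap.toMatrix' C, ?_, hC⟩
  rw [Matrix.mem_specialUnitaryGroup_iff, Matrix.mem_unitaryGroup_iff']
  constructor
  · ext i j
    have h := hinner (Pi.single i 1) (Pi.single j 1)
    have h2 : (star (LinearMap.toMatrix' C) * LinearMap.toMatrix' C) i j =
        star (B (Pi.single i 1)) ⬝ᵥ B (Pi.single j 1) := by
      simp only [Matrix.mul_apply, dotProduct, Matrix.star_apply, LinearMap.toMatrix'_apply,
        Pi.star_apply]
      rfl
    rw [h2, h]
    simp [Matrix.one_apply, Pi.single_apply, dotProduct, eq_comm]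
  -- In `hdet` the images of the basis vectors are rows; in `LinearMap.toMatrix'` they are columns.
  · rw [← hdet, ← Matrix.det_transpose]
    congr 1

theorem IsLocalFactor.hasHolonomyInSU (hF : IsLocalFactor g.inner Ω Set.univ D)
    (hS : IsSUStructure (rescaleMetric D g.inner) (rescaleForm D Ω)) :
    HasHolonomyInSU n (rescaleMetric D g.inner) := by
  intro x
  obtain ⟨L, hJ, hh, hΩ⟩ := hS.frame x
  refine ⟨L, hh, fun A hA => ?_⟩
  obtain ⟨γ, hγ, h0, h1, hA⟩ := hA
  choose V hV hV0 hV1 using hA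
  have hmet : ∀ v w, rescaleMetric D g.inner x (A v) (A w) = rescaleMetric D g.inner x v w := by
    intro v w
    have h := hF.holonomy_preserves_metric hγ h0 h1 (hV v) (hV w)
    rw [hV0, hV0, hV1, hV1] at h
    exact h
  have hmetJ : ∀ v w, rescaleMetric D g.inner x (J x (A v)) (A w) =
      rescaleMetric D g.inner x (J x v) w := by
    intro v w
    have h := hF.holonomy_preserves_metric hγ h0 h1 (hF.isParallelAlong_J hγ (hV v)) (hV w)
    rw [hV0, hV0, hV1, hV1] at h
    exact h
  have hpos : ∀ v, v ≠ 0 → 0 < rescaleMetric D g.inner x v v := fun v hv =>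
    mul_pos (hF.pos x (Set.mem_univ x)) (g.pos x v hv)
  have hinj : Function.Injective A := by
    rw [injective_iff_map_eq_zero]
    intro v hv
    by_contra hne
    have h := hpos v hne
    rw [← hmet, hv] at h
    simp at h
  have hsurj : Function.Surjective A := by
    let A' : E →L[ℝ] E := A
    exact LinearMap.surjective_of_injective (f := A'.toLinearMap) hinj
  have hAJ : ∀ v, A (J x v) = J x (A v) := fun v => by
    refine eq_of_pos (E := E) hpos fun w => ?_
    obtain ⟨w, rfl⟩ := hsurj w
    -- Both A(Jv) and J(Av) pair with Aw to h(Jv, w); surjectivity of A and definiteness of h then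
    -- identify them.
    exact (hmet _ _).trans (hmetJ _ _).symm
  have hform : ∀ v : Fin n → TangentSpace 𝓘(ℝ, E) x,
      rescaleForm D Ω x (fun i => A (v i)) = rescaleForm D Ω x v := fun v => by
    have h := eq_of_forall_hasDerivAt_zero (hF.hasDerivAt_form hS hγ fun i => hV (v i)) 1 0
    simp only [h0, h1, hV0, hV1] at h
    exact h
  let B : (Fin n → ℂ) →ₗ[ℝ] (Fin n → ℂ) :=
    ((L : TangentSpace 𝓘(ℝ, E) x →L[ℝ] (Fin n → ℂ)).comp
      (A.comp (L.symm : (Fin n → ℂ) →L[ℝ] TangentSpace 𝓘(ℝ, E) x))).toLinearMap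
  have hB : ∀ z, B z = L (A (L.symm z)) := fun z => rfl
  have hLI : ∀ z, L.symm (Complex.I • z) = J x (L.symm z) := fun z => by
    apply L.injective
    rw [hJ, L.apply_symm_apply, L.apply_symm_apply]
  obtain ⟨U, hU, hBU⟩ := exists_specialUnitary B
    (fun z => by rw [hB, hB, hLI, hAJ, hJ])
    (fun z w => by
      rw [hB, hB, ← hh, hmet, hh, L.apply_symm_apply, L.apply_symm_apply])
    (by
      have h := hform fun i => L.symm (Pi.single i 1)
      rw [hΩ, hΩ] at h
      simp only [hB]
      rw [h, ← Matrix.det_one (n := Fin n)]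
      congr 1
      ext i j
      simp [Matrix.one_apply, Pi.single_apply, eq_comm])
  exact ⟨U, hU, fun v => by rw [← hBU, hB, L.symm_apply_apply]⟩

end Holonomy

end LCCY

/-! ### The corollary -/

theorem mainTheorem3 {E : Type*} [NormedAddCommGroup E] [NormedSpace ℂ E]
    [FiniteDimensional ℂ E] (n : ℕ) (hn : Module.finrank ℂ E = n)
    {M : Type*} [TopologicalSpace M] [T2Space M] [SecondCountableTopology M]
    [ChartedSpace E M] [IsManifold 𝓘(ℂ, E) ω M] [SimplyConnectedSpace M]
    (g : LCCY.Metric E M) (Ω : LCCY.CForm E M n)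
    (h : LCCY.IsLocallyConformalCalabiYau g.inner Ω) :
    (∃! φ : LCCY.OneForm E M, LCCY.IsLeeForm g.inner Ω φ) ∧
    ∀ φ : LCCY.OneForm E M, LCCY.IsLeeForm g.inner Ω φ →
      ∃ f : M → ℝ, ContMDiff 𝓘(ℝ, E) 𝓘(ℝ, ℝ) ∞ f ∧ (∀ x, φ x = mvfderiv 𝓘(ℝ, E) f x) ∧
        ∃ (g' : LCCY.Metric E M) (Ω' : LCCY.CForm E M n),
          g'.inner = LCCY.rescaleMetric (fun x => Real.exp (-f x)) g.inner ∧
          Ω' = LCCY.rescaleForm (fun x => Real.exp (-f x)) Ω ∧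
          LCCY.IsSUStructure g'.inner Ω' ∧
          LCCY.IsKahlerOn g'.inner Set.univ ∧
          LCCY.IsRicciFlatOn g'.inner Set.univ ∧
          LCCY.IsParallelOn g'.inner Ω' Set.univ ∧
          Ω'.IsHolomorphic ∧
          LCCY.IsCalabiYau n g'.inner := by
  refine ⟨h.existsUnique_isLeeForm hn, fun φ hφ => ?_⟩
  obtain ⟨f, hf, hφf⟩ := LCCY.exists_primitive φ fun x => by
    obtain ⟨U, Δ, hx, hF, hφU⟩ := hφ.locally_factor x
    exact ⟨U, fun z => -Real.log (Δ z), hF.isOpen, hx, hF.contMDiffOn_log.neg, fun y hy =>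
      (hφU y hy).trans (mvfderiv_fun_neg (g := fun z => Real.log (Δ z))).symm⟩
  have hD : ContMDiff 𝓘(ℝ, E) 𝓘(ℝ, ℝ) ∞ fun x => Real.exp (-f x) :=
    Real.contDiff_exp.contMDiff.comp hf.neg
  have hpos : ∀ x, 0 < Real.exp (-f x) := fun x => Real.exp_pos _
  have hS := h.suStructure.rescale hD hpos
  have hF : LCCY.IsLocalFactor g.inner Ω Set.univ fun x => Real.exp (-f x) := by
    refine LCCY.isLocalFactor_univ hD hpos fun x => ?_
    obtain ⟨U, Δ, hx, hF, hφU⟩ := hφ.locally_factor x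
    -- As f + log Δ is constant near x, e^(-f) = e^(-(f + log Δ)) Δ is a constant times Δ there.
    refine ⟨U, Δ, Real.exp (-(f x + Real.log (Δ x))), Real.exp_pos _, hx, hF, ?_⟩
    have hdl : ∀ y ∈ U, MDifferentiableAt 𝓘(ℝ, E) 𝓘(ℝ, ℝ) (fun z => Real.log (Δ z)) y :=
      fun y hy => (hF.contMDiffOn_log.contMDiffAt (hF.isOpen.mem_nhds hy)).mdifferentiableAt
        (by simp)
    have hdf : ∀ y, MDifferentiableAt 𝓘(ℝ, E) 𝓘(ℝ, ℝ) f y := fun y =>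
      (hf y).mdifferentiableAt (by simp)
    have hev := LCCY.eventually_eq_of_mvfderiv_eq_zero (E := E)
      (F := fun y => f y + Real.log (Δ y)) hF.isOpen
      (fun y hy => ((hdf y).add (hdl y hy)).mdifferentiableWithinAt)
      (fun y hy => by
        rw [mvfderiv_fun_add (hdf y) (hdl y hy), ← hφf y, hφU y hy, neg_add_cancel]) hx
    filter_upwards [hev, hF.isOpen.mem_nhds hx] with y hy hyU
    rw [← hy]
    conv_rhs => rw [← Real.exp_log (hF.pos y hyU), ← Real.exp_add, Real.log_exp]
    congr 1
    ring
  have hhol := hF.isHolomorphic h.suStructure hS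
  refine ⟨f, hf, hφf, g.rescale _ hD hpos, _, rfl, rfl, hS, hF.kahler, hF.ricciFlat, hF.parallel,
    hhol, hF.kahler, ⟨_, hhol, fun x hx => ?_⟩, hF.hasHolonomyInSU hS⟩
  -- The holomorphic form Ω' itself trivializes the canonical bundle, as it takes the value 1 at
  -- each point.
  obtain ⟨v, hv⟩ := hS.exists_apply_eq_one x
  rw [hx] at hv
  simp at hv
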